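/- Let $\mathbb D$ be the open unit disc, $\mathbb T$ the unit circle, $m$ the normalized arc-length measure on $\mathbb T$ and $dA=\frac{dx\,dy}{\pi}$ the normalized area measure on $\mathbb D$. Let $\mu$ be a positive Borel measure on $\mathbb D$ with $\int_{\mathbb D}(1-|w|^2)\,d\mu(w)<\infty$. For a holomorphic function $f$ on $\mathbb D$ put $$\mathcal D_\mu(f)=\int_{\mathbb D}|f'(z)|^2\,G_\mu(z)\,dA(z)\in[0,\infty],\qquad G_\mu(z)=\int_{\mathbb D}\log\left|\frac{1-\overline w z}{z-w}\right|^2d\mu(w).$$ For $w\in\mathbb D$ let $d\sigma_w(\zeta)=\frac{1-|w|^2}{|\zeta-w|^2}\,dm(\zeta)$ be the harmonic measure of $\mathbb D$ at $w$, and for $x,y\in\mathbb R$ let $F(x,y)=e^x-e^y-e^y(x-y)$, the Bregman divergence of the exponential function. Let $f$ belong to the Hardy space $H^2$ and be outer, that is, $$f(z)=\alpha\exp\left(\int_{\mathbb T}\frac{\zeta+z}{\zeta-z}\,h(\zeta)\,dm(\zeta)\right),\qquad z\in\mathbb D,$$ for some constant $\alpha$ with $|\alpha|=1$ and some real-valued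 $h\in L^1(\mathbb T,m)$. Write $f(\zeta)=\lim_{r\to1^-}f(r\zeta)$ for the radial limit, which exists for $m$-almost every $\zeta\in\mathbb T$. Then $$\mathcal D_\mu(f)=\int_{\mathbb D}\ \inf_{a\in\mathbb R}\int_{\mathbb T}F\bigl(2\log|f(\zeta)|,a\bigr)\,d\sigma_w(\zeta)\,d\mu(w),$$ as an identity in $[0,\infty]$ (both sides may be $+\infty$). -/

import Mathlib

open MeasureTheory
open scoped ENNReal Topology ComplexConjugate

noncomputable section

namespace DirichletOuter

/-- The open unit disc. -/
def disc : Set ℂ := Metric.ball 0 1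

/-- Normalized arc-length measure on the unit circle, as a Borel measure on `ℂ` carried by
the unit circle. -/
def m : Measure ℂ :=
  ENNReal.ofReal (2 * Real.pi)⁻¹ •
    (volume.restrict (Set.Ioc 0 (2 * Real.pi))).map (circleMap 0 1)

/-- Normalized area measure `dx dy / π` on the unit disc. -/
def area : Measure ℂ := ENNReal.ofReal Real.pi⁻¹ • volume.restrict disc

/-- The harmonic measure of the unit disc at `w`: Poisson kernel times arc length. -/
def σ (w : ℂ) : Measure ℂ :=
  m.withDensity fun ζ => ENNReal.ofReal ((1 - ‖w‖ ^ 2) / ‖ζ - w‖ ^ 2)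

/-- Membership in the Hardy space `H^p` of the unit disc, for `0 < p < ∞`. -/
def MemHardy (p : ℝ) (f : ℂ → ℂ) : Prop :=
  DifferentiableOn ℂ f disc ∧
    ∃ C : ℝ, ∀ r : ℝ, 0 ≤ r → r < 1 → Real.circleAverage (fun z => ‖f z‖ ^ p) 0 r ≤ C

/-- Outer functions: elements of `H^1` which are, up to a unimodular constant, the exponential
of the Herglotz integral of a real integrable function on the circle. -/
def IsOuter (f : ℂ → ℂ) : Prop :=
  MemHardy 1 f ∧
    ∃ (α : ℂ) (h : ℂ → ℝ), ‖α‖ = 1 ∧ Integrable h m ∧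
      ∀ z ∈ disc, f z = α * Complex.exp (∫ ζ, (ζ + z) / (ζ - z) * (h ζ : ℂ) ∂m)

/-- The radial limit of `f` at the boundary point `ζ`. -/
def boundaryValue (f : ℂ → ℂ) (ζ : ℂ) : ℂ :=
  Filter.limUnder (𝓝[<] (1 : ℝ)) fun r : ℝ => f ((r : ℂ) * ζ)

/-- Green kernel of the unit disc, with the normalization `log |(1 - \bar w z)/(z - w)|²` and
the value `∞` on the diagonal. -/
def greenKernel (z w : ℂ) : ℝ≥0∞ :=
  if z = w then ⊤ else ENNReal.ofReal (Real.log (‖(1 - conj w * z) / (z - w)‖ ^ 2))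

/-- Green potential of the restriction of `μ` to the unit disc. -/
def greenPotential (μ : Measure ℂ) (z : ℂ) : ℝ≥0∞ :=
  ∫⁻ w in disc, greenKernel z w ∂μ

/-- The weighted Dirichlet integral of `f` with weight `ω`. -/
def dirichletIntegral (ω : ℂ → ℝ≥0∞) (f : ℂ → ℂ) : ℝ≥0∞ :=
  ∫⁻ z, ENNReal.ofReal (‖deriv f z‖ ^ 2) * ω z ∂area

/-- The Bregman divergence of the exponential function; it is nonnegative. -/
def F (x y : ℝ) : ℝ := Real.exp x - Real.exp y - Real.exp y * (x - y)

end DirichletOuter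

end

namespace DirichletOuter

/-! ### The circle measure and harmonic measures -/

/-! By Tonelli it is enough to treat one pole `w`, that is, to prove that `∫ |f'|² log |(1 - conj w
z)/(z - w)|² dA` equals the infimum over `a` of `∫ F(2 log |f|, a) dσ_w`. Both sides are the Jensen
gap of the exponential for `2 log |f|` under `σ_w`.

On the Dirichlet side, the Littlewood–Paley identity evaluates the integral as `∫ |f|² dσ_w -
|f(w)|²` (`lintegral_deriv_sq_greenKernel_eq`). A disc automorphism moves the pole to the origin,
where the identity is Parseval's formula, because the logarithmic weight gives each Taylor
coefficient except the constant one the weight one. This is done for polynomials, which stay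
holomorphic past the closed disc after the automorphism, and extended to `H²` by `L²` limits.

Outerness says that `log |f|` is the Poisson integral of `h`, so `|f(w)|² = exp (∫ 2h dσ_w)`.
Fatou's theorem (`ae_tendsto_integral_σ_radial`) identifies the radial limit with the `L²` boundary
function `u` and gives `|u| = exp h` almost everywhere.

On the Bregman side, for a probability measure the mean of `F(k, a)` is the Jensen gap `∫ exp k -
exp (∫ k)` plus `F(∫ k, a)`. The last term is nonnegative and vanishes at `a = ∫ k`
(`iInf_lintegral_F`). -/

instance isProbabilityMeasure_m : IsProbabilityMeasure m := by
  constructor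
  rw [m, Measure.smul_apply, Measure.map_apply (by fun_prop) MeasurableSet.univ]
  simp only [Set.preimage_univ, Measure.restrict_apply MeasurableSet.univ, Set.univ_inter,
    Real.volume_Ioc, sub_zero, smul_eq_mul]
  rw [← ENNReal.ofReal_mul (by positivity), inv_mul_cancel₀ (by positivity), ENNReal.ofReal_one]

/-- A property that holds at almost every angle holds `m`-almost everywhere. -/
theorem ae_m_of_ae_angle {Q : ℂ → Prop}
    (hQ : ∀ᵐ θ ∂(volume : Measure ℝ), θ ∈ Set.Ioc 0 (2 * Real.pi) → Q (circleMap 0 1 θ)) :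
    ∀ᵐ ζ ∂m, Q ζ := by
  have hinj : Set.InjOn (circleMap 0 1) (Set.Ioc 0 (2 * Real.pi)) := by
    rw [← Set.uIoc_of_le Real.two_pi_pos.le]
    exact injOn_circleMap_of_abs_sub_le one_ne_zero (by simp [abs_of_pos Real.pi_pos])
  have hsphere : ∀ᵐ ζ ∂m, ζ ∈ circleMap 0 1 '' Set.Ioc 0 (2 * Real.pi) := by
    rw [m]
    refine Measure.ae_smul_measure ?_ _
    rw [ae_map_iff (by fun_prop)]
    · filter_upwards [ae_restrict_mem measurableSet_Ioc] with θ hθ using ⟨θ, hθ, rfl⟩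
    · exact measurableSet_Ioc.image_of_measurable_injOn (by fun_prop) hinj
  -- `Q` need not be measurable: the bad angles are enclosed in a Borel null set, whose image under
  -- the injective circle map is again Borel.
  obtain ⟨N, hN, hNm, hN0⟩ := exists_measurable_superset_of_null (ae_iff.1 hQ)
  have hNm' : MeasurableSet (N ∩ Set.Ioc 0 (2 * Real.pi)) := hNm.inter measurableSet_Ioc
  have himg : MeasurableSet (circleMap 0 1 '' (N ∩ Set.Ioc 0 (2 * Real.pi))) :=
    hNm'.image_of_measurable_injOn (by fun_prop) (hinj.mono Set.inter_subset_right)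
  have h0 : m (circleMap 0 1 '' (N ∩ Set.Ioc 0 (2 * Real.pi))) = 0 := by
    rw [m, Measure.smul_apply, Measure.map_apply (by fun_prop) himg,
      Measure.restrict_apply (himg.preimage (by fun_prop))]
    refine smul_eq_zero_of_right _ (measure_mono_null ?_ hN0)
    rintro θ ⟨⟨θ', ⟨h1, h2⟩, h3⟩, hθ⟩
    rwa [← hinj h2 hθ h3]
  filter_upwards [hsphere, measure_eq_zero_iff_ae_notMem.1 h0] with ζ h1 h2
  obtain ⟨θ, hθ, rfl⟩ := h1
  by_contra hq
  exact h2 ⟨θ, ⟨hN (by simpa using ⟨hθ.1, hθ.2, hq⟩), hθ⟩, rfl⟩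

theorem ae_m_norm_eq_one : ∀ᵐ ζ ∂m, ‖ζ‖ = 1 :=
  ae_m_of_ae_angle (.of_forall fun θ _ => by simp)

theorem integral_m {E : Type*} [NormedAddCommGroup E] [NormedSpace ℝ E] {u : ℂ → E}
    (hu : AEStronglyMeasurable u m) : ∫ ζ, u ζ ∂m = Real.circleAverage u 0 1 := by
  have hu' : AEStronglyMeasurable u
      ((volume.restrict (Set.Ioc 0 (2 * Real.pi))).map (circleMap 0 1)) := by
    refine hu.mono_ac ?_
    rw [m]
    exact Measure.absolutelyContinuous_smul (by simp [Real.pi_pos])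
  rw [m, integral_smul_measure, integral_map (by fun_prop) hu', Real.circleAverage_def,
    intervalIntegral.integral_of_le Real.two_pi_pos.le, ENNReal.toReal_ofReal (by positivity)]

theorem lintegral_m {u : ℂ → ℝ≥0∞} (hu : Measurable u) :
    ∫⁻ ζ, u ζ ∂m = ENNReal.ofReal (2 * Real.pi)⁻¹ *
      ∫⁻ θ in Set.Ioc 0 (2 * Real.pi), u (circleMap 0 1 θ) := by
  rw [m, lintegral_smul_measure, lintegral_map hu (by fun_prop), smul_eq_mul]

theorem intervalIntegrable_of_integrable_m {E : Type*} [NormedAddCommGroup E] {u : ℂ → E}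
    (hu : Integrable u m) :
    IntervalIntegrable (fun θ => u (circleMap 0 1 θ)) volume 0 (2 * Real.pi) := by
  rw [m, integrable_smul_measure (by simp [Real.pi_pos]) (by simp)] at hu
  rw [intervalIntegrable_iff_integrableOn_Ioc_of_le Real.two_pi_pos.le]
  exact hu.comp_measurable (by fun_prop)

/-- The Poisson kernel of the unit disc, with pole `w`. -/
noncomputable def poisson (w ζ : ℂ) : ℝ := (1 - ‖w‖ ^ 2) / ‖ζ - w‖ ^ 2

@[fun_prop]
theorem measurable_poisson (w : ℂ) : Measurable (poisson w) := by
  unfold poisson; fun_prop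

theorem poisson_nonneg {w : ℂ} (hw : w ∈ disc) (ζ : ℂ) : 0 ≤ poisson w ζ := by
  have : ‖w‖ < 1 := by simpa [disc] using hw
  exact div_nonneg (by nlinarith [norm_nonneg w]) (by positivity)

theorem poisson_le {w : ℂ} (hw : w ∈ disc) {ζ : ℂ} (hζ : ‖ζ‖ = 1) :
    poisson w ζ ≤ (1 - ‖w‖ ^ 2) / (1 - ‖w‖) ^ 2 := by
  have h1 : ‖w‖ < 1 := by simpa [disc] using hw
  have h2 : 1 - ‖w‖ ≤ ‖ζ - w‖ := by simpa [hζ] using norm_sub_norm_le ζ w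
  have h3 : 0 < 1 - ‖w‖ := by linarith
  unfold poisson
  gcongr
  nlinarith [norm_nonneg w]

theorem integral_σ {E : Type*} [NormedAddCommGroup E] [NormedSpace ℝ E] {w : ℂ} (hw : w ∈ disc)
    (u : ℂ → E) : ∫ ζ, u ζ ∂(σ w) = ∫ ζ, poisson w ζ • u ζ ∂m := by
  have : σ w = m.withDensity fun ζ => ENNReal.ofReal (poisson w ζ) := rfl
  rw [this, integral_withDensity_eq_integral_toReal_smul (by fun_prop) (by simp)]
  simp [ENNReal.toReal_ofReal (poisson_nonneg hw _)]

theorem σ_absolutelyContinuous (w : ℂ) : σ w ≪ m := withDensity_absolutelyContinuous _ _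

/-- For a fixed pole the Poisson kernel is bounded on the circle. This domination carries
integrability and `L²` convergence from `m` to every `σ w`. -/
theorem σ_le {w : ℂ} (hw : w ∈ disc) :
    σ w ≤ ENNReal.ofReal ((1 - ‖w‖ ^ 2) / (1 - ‖w‖) ^ 2) • m := by
  rw [← withDensity_const]
  refine withDensity_mono ?_
  filter_upwards [ae_m_norm_eq_one] with ζ hζ
  exact ENNReal.ofReal_le_ofReal (poisson_le hw hζ)

instance isFiniteMeasure_m_smul (c : ℝ) : IsFiniteMeasure (ENNReal.ofReal c • m) :=
  Measure.smul_finite _ (by simp)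

theorem isFiniteMeasure_σ {w : ℂ} (hw : w ∈ disc) : IsFiniteMeasure (σ w) :=
  isFiniteMeasure_of_le _ (σ_le hw)

theorem integrable_σ {E : Type*} [NormedAddCommGroup E] {w : ℂ} (hw : w ∈ disc) {u : ℂ → E}
    (hu : Integrable u m) : Integrable u (σ w) :=
  (hu.smul_measure ENNReal.ofReal_ne_top).mono_measure (σ_le hw)

/-- A function continuous on the unit circle is integrable for the arc-length measure. -/
theorem integrable_m_of_continuousOn {E : Type*} [NormedAddCommGroup E] {u : ℂ → E}
    (hu : ContinuousOn u (Metric.sphere 0 1)) : Integrable u m := by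
  have hr : m.restrict (Metric.sphere 0 1) = m :=
    Measure.restrict_eq_self_of_ae_mem (by simpa using ae_m_norm_eq_one)
  rw [← hr]
  exact hu.integrableOn_compact (isCompact_sphere _ _)

/-- Functions of the disc algebra are the Poisson integrals of their boundary values. -/
theorem integral_σ_of_diffContOnCl {q : ℂ → ℂ} (hq : DiffContOnCl ℂ q (Metric.ball 0 1)) {w : ℂ}
    (hw : w ∈ disc) : ∫ ζ, q ζ ∂(σ w) = q w := by
  have hi : Integrable q m := by
    refine integrable_m_of_continuousOn (hq.continuousOn_ball.mono ?_)
    exact Metric.sphere_subset_closedBall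
  have hm : AEStronglyMeasurable (fun ζ => poisson w ζ • q ζ) m :=
    (measurable_poisson w).aestronglyMeasurable.smul hi.1
  rw [integral_σ hw, integral_m hm, ← hq.circleAverage_poissonKernel_smul hw]
  refine Real.circleAverage_congr_sphere fun ζ hζ => ?_
  have : ‖ζ‖ = 1 := by simpa using hζ
  simp [poisson, poissonKernel, this]

theorem isProbabilityMeasure_σ {w : ℂ} (hw : w ∈ disc) : IsProbabilityMeasure (σ w) := by
  have := isFiniteMeasure_σ hw
  have h := integral_σ_of_diffContOnCl (q := fun _ => 1) diffContOnCl_const hw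
  simp only [integral_const] at h
  refine ⟨?_⟩
  rw [← ENNReal.toReal_eq_one_iff]
  simpa [Measure.real] using h

/-! ### Fatou's theorem on radial limits of Poisson integrals -/

/-- The Poisson kernel of radius `r` as a function of the angle. -/
noncomputable def anglePoisson (r t : ℝ) : ℝ := (1 - r ^ 2) / (1 - 2 * r * Real.cos t + r ^ 2)

/-- The derivative of the Poisson kernel with respect to the angle. -/
noncomputable def anglePoissonDeriv (r t : ℝ) : ℝ :=
  -((1 - r ^ 2) * (2 * r * Real.sin t)) / (1 - 2 * r * Real.cos t + r ^ 2) ^ 2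

theorem anglePoisson_denom_pos {r : ℝ} (h0 : 0 < r) (h1 : r < 1) (t : ℝ) :
    0 < 1 - 2 * r * Real.cos t + r ^ 2 := by
  nlinarith [Real.cos_le_one t, sq_nonneg (1 - r)]

theorem hasDerivAt_anglePoisson {r : ℝ} (h0 : 0 < r) (h1 : r < 1) (t : ℝ) :
    HasDerivAt (anglePoisson r) (anglePoissonDeriv r t) t := by
  have h := (((Real.hasDerivAt_cos t).const_mul (2 * r)).const_sub 1).add_const (r ^ 2)
  convert! (hasDerivAt_const t (1 - r ^ 2)).div h (anglePoisson_denom_pos h0 h1 t).ne' using 1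
  rw [anglePoissonDeriv]
  congr 1
  ring

theorem continuous_anglePoissonDeriv {r : ℝ} (h0 : 0 < r) (h1 : r < 1) :
    Continuous (anglePoissonDeriv r) := by
  unfold anglePoissonDeriv
  exact Continuous.div (by fun_prop) (by fun_prop)
    fun t => (pow_pos (anglePoisson_denom_pos h0 h1 t) 2).ne'

theorem contDiff_anglePoisson {r : ℝ} (h0 : 0 < r) (h1 : r < 1) :
    ContDiff ℝ 1 (anglePoisson r) := by
  unfold anglePoisson
  exact ContDiff.div (by fun_prop) (by fun_prop) fun t => (anglePoisson_denom_pos h0 h1 t).ne'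

theorem anglePoisson_pi {r : ℝ} (h0 : 0 < r) : anglePoisson r Real.pi = (1 - r) / (1 + r) := by
  rw [anglePoisson, Real.cos_pi, div_eq_div_iff (by nlinarith) (by linarith)]
  ring

theorem norm_circleMap_sub_sq (r θ t : ℝ) :
    ‖circleMap 0 1 (θ + t) - r * circleMap 0 1 θ‖ ^ 2 = 1 - 2 * r * Real.cos t + r ^ 2 := by
  have : circleMap 0 1 (θ + t) - r * circleMap 0 1 θ
      = circleMap 0 1 θ * (circleMap 0 1 t - r) := by
    simp only [circleMap, zero_add, Complex.ofReal_add, add_mul, Complex.exp_add]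
    push_cast
    ring
  rw [this, norm_mul, norm_circleMap_zero, abs_one, one_mul, ← Complex.normSq_eq_norm_sq,
    Complex.normSq_apply]
  simp only [circleMap, zero_add, Complex.ofReal_one, one_mul, Complex.sub_re, Complex.sub_im,
    Complex.exp_ofReal_mul_I_re, Complex.exp_ofReal_mul_I_im, Complex.ofReal_re, Complex.ofReal_im]
  nlinarith [Real.sin_sq_add_cos_sq t]

theorem radial_mem_disc {r : ℝ} (h0 : 0 < r) (h1 : r < 1) {ζ : ℂ} (hζ : ‖ζ‖ = 1) :
    (r : ℂ) * ζ ∈ disc := by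
  simp [disc, hζ, abs_of_pos h0, h1]

/-- The Poisson integral along a radius, in angular coordinates. -/
theorem integral_σ_radial {u : ℂ → ℝ} (hu : AEStronglyMeasurable u m) {r : ℝ} (h0 : 0 < r)
    (h1 : r < 1) (θ : ℝ) :
    ∫ ζ, u ζ ∂(σ (r * circleMap 0 1 θ)) =
      (2 * Real.pi)⁻¹ * ∫ t in -Real.pi..Real.pi,
        anglePoisson r t * u (circleMap 0 1 (θ + t)) := by
  set w : ℂ := r * circleMap 0 1 θ with hw
  have hwd : w ∈ disc := radial_mem_disc h0 h1 (by simp)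
  have hm : AEStronglyMeasurable (fun ζ => poisson w ζ • u ζ) m :=
    (measurable_poisson w).aestronglyMeasurable.smul hu
  rw [integral_σ hwd, integral_m hm, Real.circleAverage_def, smul_eq_mul]
  congr 1
  -- Periodicity allows the window of integration to be recentred at `θ`, after which the kernel
  -- depends only on the angle `t` measured from `θ`.
  have hper : Function.Periodic
      (fun s => poisson w (circleMap 0 1 s) • u (circleMap 0 1 s)) (2 * Real.pi) := fun s => by
    simp [periodic_circleMap 0 1 s]
  have h2 := hper.intervalIntegral_add_eq 0 (θ + -Real.pi)
  rw [zero_add] at h2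
  rw [h2, show θ + -Real.pi + 2 * Real.pi = θ + Real.pi by ring,
    ← intervalIntegral.integral_comp_add_left]
  refine intervalIntegral.integral_congr fun t _ => ?_
  simp only [smul_eq_mul, poisson, anglePoisson]
  rw [hw, norm_circleMap_sub_sq]
  simp

theorem integral_anglePoisson {r : ℝ} (h0 : 0 < r) (h1 : r < 1) :
    (2 * Real.pi)⁻¹ * ∫ t in -Real.pi..Real.pi, anglePoisson r t = 1 := by
  have h := integral_σ_radial (u := fun _ => (1 : ℝ)) aestronglyMeasurable_const h0 h1 0
  have := isProbabilityMeasure_σ (radial_mem_disc h0 h1 (ζ := circleMap 0 1 0) (by simp))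
  simpa using h.symm

/-- Integration by parts against the primitive of `W`. As `W` is merely integrable, the primitive is
only absolutely continuous, with derivative `W` almost everywhere. The kernel is even, so the
boundary terms combine into its value at `π` times the full integral of `W`. -/
theorem integral_anglePoisson_mul {W : ℝ → ℝ} (hW : ∀ a b, IntervalIntegrable W volume a b)
    {r : ℝ} (h0 : 0 < r) (h1 : r < 1) :
    ∫ t in -Real.pi..Real.pi, anglePoisson r t * W t =
      (1 - r) / (1 + r) * (∫ t in -Real.pi..Real.pi, W t) -
        ∫ t in -Real.pi..Real.pi, anglePoissonDeriv r t * ∫ s in 0..t, W s := by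
  set V : ℝ → ℝ := fun t => ∫ s in 0..t, W s with hV
  have hVac : AbsolutelyContinuousOnInterval V (-Real.pi) Real.pi :=
    (hW _ _).absolutelyContinuousOnInterval_intervalIntegral
      (Set.mem_uIcc.2 (Or.inl ⟨by linarith [Real.pi_pos], Real.pi_pos.le⟩))
  have hPac : AbsolutelyContinuousOnInterval (anglePoisson r) (-Real.pi) Real.pi :=
    (contDiff_anglePoisson h0 h1).contDiffOn.absolutelyContinuousOnInterval
  have hparts := hPac.integral_mul_deriv_eq_deriv_mul hVac
  have hder : ∫ t in -Real.pi..Real.pi, anglePoisson r t * deriv V t =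
      ∫ t in -Real.pi..Real.pi, anglePoisson r t * W t := by
    refine intervalIntegral.integral_congr_ae ?_
    filter_upwards [(hW (-Real.pi) Real.pi).ae_hasDerivAt_integral] with t ht htm
    rw [(ht (Set.uIoc_subset_uIcc htm) 0
      (Set.mem_uIcc.2 (Or.inl ⟨by linarith [Real.pi_pos], Real.pi_pos.le⟩))).deriv]
  have heven : anglePoisson r (-Real.pi) = anglePoisson r Real.pi := by simp [anglePoisson]
  have hsub : V Real.pi - V (-Real.pi) = ∫ t in -Real.pi..Real.pi, W t := by
    rw [hV]
    exact intervalIntegral.integral_interval_sub_left (hW _ _) (hW _ _)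
  rw [← hder, hparts, heven, ← mul_sub, hsub, anglePoisson_pi h0]
  congr 1
  exact intervalIntegral.integral_congr fun t _ => by
    simp only [(hasDerivAt_anglePoisson h0 h1 t).deriv, hV]

/-- The approximate identity obtained from the angular derivative of the Poisson kernel. -/
noncomputable def fatouKernel (r t : ℝ) : ℝ := (2 * Real.pi)⁻¹ * -(t * anglePoissonDeriv r t)

theorem fatouKernel_nonneg {r : ℝ} (h0 : 0 < r) (h1 : r < 1) {t : ℝ}
    (ht : t ∈ Set.Icc (-Real.pi) Real.pi) : 0 ≤ fatouKernel r t := by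
  have hs : 0 ≤ t * Real.sin t := by
    rcases le_total 0 t with h | h
    · exact mul_nonneg h (Real.sin_nonneg_of_nonneg_of_le_pi h ht.2)
    · exact mul_nonneg_of_nonpos_of_nonpos h (Real.sin_nonpos_of_nonpos_of_neg_pi_le h ht.1)
  have : -(t * anglePoissonDeriv r t) =
      (1 - r ^ 2) * (2 * r) * (t * Real.sin t) / (1 - 2 * r * Real.cos t + r ^ 2) ^ 2 := by
    rw [anglePoissonDeriv]; ring
  rw [fatouKernel, this]
  have : 0 ≤ 1 - r ^ 2 := by nlinarith
  positivity

/-- The denominator is the square of `(1 - r)² + 2r(1 - cos t)`, which is at least `1 - cos t` once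
`r > 1/2`, and `1 - cos t ≥ 2t²/π²` on `[-π, π]`. Hence the kernel tends to zero uniformly away from
`t = 0` as `r → 1`. -/
theorem fatouKernel_le {r δ : ℝ} (h0 : 1 / 2 < r) (h1 : r < 1) (hδ : 0 < δ) {t : ℝ}
    (ht : t ∈ Set.Icc (-Real.pi) Real.pi) (hδt : δ ≤ |t|) :
    fatouKernel r t ≤ (1 - r ^ 2) / (2 / Real.pi ^ 2 * δ ^ 2) ^ 2 := by
  have h0' : 0 < r := by linarith
  have hcos := Real.cos_le_one_sub_mul_cos_sq (x := t) (abs_le.2 ht)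
  have hsq : δ ^ 2 ≤ t ^ 2 := by rw [← sq_abs t]; gcongr
  have hc : 2 / Real.pi ^ 2 * δ ^ 2 ≤ 1 - Real.cos t := by
    have : 2 / Real.pi ^ 2 * δ ^ 2 ≤ 2 / Real.pi ^ 2 * t ^ 2 := by gcongr
    linarith
  have hden : 2 / Real.pi ^ 2 * δ ^ 2 ≤ 1 - 2 * r * Real.cos t + r ^ 2 := by
    nlinarith [sq_nonneg (1 - r), Real.cos_le_one t]
  have hr : 0 ≤ 1 - r ^ 2 := by nlinarith
  have hts : t * Real.sin t ≤ Real.pi := by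
    calc t * Real.sin t ≤ |t * Real.sin t| := le_abs_self _
      _ = |t| * |Real.sin t| := abs_mul _ _
      _ ≤ Real.pi * 1 := by gcongr; exacts [abs_le.2 ht, Real.abs_sin_le_one t]
      _ = Real.pi := mul_one _
  have : fatouKernel r t = (1 - r ^ 2) * ((Real.pi)⁻¹ * (r * (t * Real.sin t))) /
      (1 - 2 * r * Real.cos t + r ^ 2) ^ 2 := by
    rw [fatouKernel, anglePoissonDeriv]; field_simp
  rw [this]
  have hpos : 0 < 2 / Real.pi ^ 2 * δ ^ 2 := by positivity
  gcongr
  refine mul_le_of_le_one_right hr ?_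
  rw [inv_mul_le_iff₀ Real.pi_pos, mul_one]
  nlinarith [Real.pi_pos]

/-- The primitive of `W` is `t` times its difference quotient at `0`. Absorbing this `t` into the
kernel turns the remainder of the integration by parts into an average of difference quotients
against a nonnegative kernel. -/
theorem integral_fatouKernel_mul {W : ℝ → ℝ} (hW : ∀ a b, IntervalIntegrable W volume a b)
    {r : ℝ} (h0 : 0 < r) (h1 : r < 1) :
    (2 * Real.pi)⁻¹ * ∫ t in -Real.pi..Real.pi, anglePoisson r t * W t =
      (1 - r) / (1 + r) * ((2 * Real.pi)⁻¹ * ∫ t in -Real.pi..Real.pi, W t) +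
        ∫ t in Set.Icc (-Real.pi) Real.pi,
          fatouKernel r t • dslope (fun t => ∫ s in 0..t, W s) 0 t := by
  rw [integral_anglePoisson_mul hW h0 h1, integral_Icc_eq_integral_Ioc,
    ← intervalIntegral.integral_of_le (by linarith [Real.pi_pos]), mul_sub, sub_eq_add_neg]
  congr 1
  · ring
  rw [← intervalIntegral.integral_const_mul, ← intervalIntegral.integral_neg]
  refine intervalIntegral.integral_congr fun t _ => ?_
  have := sub_smul_dslope (fun t => ∫ s in 0..t, W s) 0 t
  simp only [sub_zero, smul_eq_mul, intervalIntegral.integral_same] at this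
  simp only [smul_eq_mul, fatouKernel]
  rw [← this]
  ring

theorem tendsto_one_sub_div_one_add :
    Filter.Tendsto (fun r : ℝ => (1 - r) / (1 + r)) (𝓝[<] 1) (𝓝 0) := by
  have : ContinuousAt (fun r : ℝ => (1 - r) / (1 + r)) 1 := by
    apply ContinuousAt.div (by fun_prop) (by fun_prop) (by norm_num)
  have h := this.tendsto
  norm_num at h
  exact h.mono_left nhdsWithin_le_nhds

theorem Ioo_half_one_mem : Set.Ioo (1 / 2 : ℝ) 1 ∈ 𝓝[<] (1 : ℝ) :=
  Ioo_mem_nhdsLT (by norm_num)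

/-- The case `W = 1`, where every difference quotient is `1`, gives the exact mass `1 - (1 - r)/(1 +
r)`. -/
theorem tendsto_integral_fatouKernel :
    Filter.Tendsto (fun r => ∫ t in Set.Icc (-Real.pi) Real.pi, fatouKernel r t)
      (𝓝[<] 1) (𝓝 1) := by
  have hcongr : ∀ᶠ r in 𝓝[<] (1 : ℝ), 1 - (1 - r) / (1 + r) =
      ∫ t in Set.Icc (-Real.pi) Real.pi, fatouKernel r t := by
    filter_upwards [Ioo_half_one_mem] with r hr
    have h0 : 0 < r := by linarith [hr.1]
    have h := integral_fatouKernel_mul (W := fun _ => 1) (fun a b => by simp) h0 hr.2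
    have hds : dslope (fun t : ℝ => ∫ _ in 0..t, (1 : ℝ)) 0 = fun _ => 1 := by
      funext t
      have : (fun t : ℝ => ∫ _ in 0..t, (1 : ℝ)) = id := by funext; simp
      rw [this]
      rcases eq_or_ne t 0 with rfl | h
      · simp
      · rw [dslope_of_ne _ h, slope_def_field]; simp [h]
    rw [hds] at h
    simp only [mul_one, integral_anglePoisson h0 hr.2, smul_eq_mul,
      intervalIntegral.integral_const] at h
    have hpi : (2 * Real.pi)⁻¹ * (Real.pi - -Real.pi) = 1 := by
      rw [sub_neg_eq_add, ← two_mul, inv_mul_cancel₀ (by positivity)]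
    rw [hpi] at h
    linarith
  refine Filter.Tendsto.congr' hcongr ?_
  simpa using tendsto_one_sub_div_one_add.const_sub 1

/-- If the primitive of `W` has derivative `c` at `0`, the radial Poisson averages of `W`
converge to `c`. -/
theorem tendsto_integral_anglePoisson {W : ℝ → ℝ} (hW : ∀ a b, IntervalIntegrable W volume a b)
    {c : ℝ} (hd : HasDerivAt (fun t => ∫ s in 0..t, W s) c 0) :
    Filter.Tendsto (fun r => (2 * Real.pi)⁻¹ * ∫ t in -Real.pi..Real.pi, anglePoisson r t * W t)
      (𝓝[<] 1) (𝓝 c) := by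
  set V : ℝ → ℝ := fun t => ∫ s in 0..t, W s with hV
  have hnhds : Set.Icc (-Real.pi) Real.pi ∈ 𝓝 (0 : ℝ) :=
    Icc_mem_nhds (by linarith [Real.pi_pos]) Real.pi_pos
  have hcont : ContinuousOn (dslope V 0) (Set.Icc (-Real.pi) Real.pi) :=
    (continuousOn_dslope hnhds).2
      ⟨(intervalIntegral.continuous_primitive hW 0).continuousOn, hd.differentiableAt⟩
  have hlim : Filter.Tendsto (dslope V 0) (𝓝[Set.Icc (-Real.pi) Real.pi] 0) (𝓝 c) := by
    have := (hcont 0 (mem_of_mem_nhds hnhds)).tendsto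
    rwa [dslope_same, hd.deriv] at this
  -- The kernels form an approximate identity at `0`, and differentiability of the primitive there
  -- is exactly continuity of its difference quotient.
  have hpeak : Filter.Tendsto (fun r => ∫ t in Set.Icc (-Real.pi) Real.pi,
      fatouKernel r t • dslope V 0 t) (𝓝[<] 1) (𝓝 c) := by
    refine tendsto_setIntegral_peak_smul_of_integrableOn_of_tendsto measurableSet_Icc
      measurableSet_Icc subset_rfl self_mem_nhdsWithin (by simp) ?_ ?_
      tendsto_integral_fatouKernel ?_ (hcont.integrableOn_compact isCompact_Icc) hlim
    · filter_upwards [Ioo_half_one_mem] with r hr t ht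
      exact fatouKernel_nonneg (by linarith [hr.1]) hr.2 ht
    · intro u hu h0u
      obtain ⟨δ, hδ, hball⟩ := Metric.isOpen_iff.1 hu 0 h0u
      rw [Metric.tendstoUniformlyOn_iff]
      intro ε hε
      have hb : Filter.Tendsto (fun r : ℝ => (1 - r ^ 2) / (2 / Real.pi ^ 2 * δ ^ 2) ^ 2)
          (𝓝[<] 1) (𝓝 0) := by
        have : Continuous fun r : ℝ => (1 - r ^ 2) / (2 / Real.pi ^ 2 * δ ^ 2) ^ 2 := by fun_prop
        have h := this.tendsto 1
        norm_num at h
        exact h.mono_left nhdsWithin_le_nhds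
      filter_upwards [Ioo_half_one_mem, hb.eventually_lt_const hε] with r hr hrε t ht
      have hδt : δ ≤ |t| := by
        by_contra hlt
        exact ht.2 (hball (by simpa using hlt))
      rw [Pi.zero_apply, dist_zero_left, Real.norm_of_nonneg
        (fatouKernel_nonneg (by linarith [hr.1]) hr.2 ht.1)]
      exact (fatouKernel_le hr.1 hr.2 hδ ht.1 hδt).trans_lt hrε
    · filter_upwards [Ioo_half_one_mem] with r hr
      have := continuous_anglePoissonDeriv (by linarith [hr.1] : 0 < r) hr.2
      unfold fatouKernel
      exact Continuous.aestronglyMeasurable (by fun_prop)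
  have hsum := (tendsto_one_sub_div_one_add.mul_const
    ((2 * Real.pi)⁻¹ * ∫ t in -Real.pi..Real.pi, W t)).add hpeak
  rw [zero_mul, zero_add] at hsum
  refine hsum.congr' ?_
  filter_upwards [Ioo_half_one_mem] with r hr
  exact (integral_fatouKernel_mul hW (by linarith [hr.1]) hr.2).symm

/-- **Fatou's theorem**: Poisson integrals of integrable functions have radial limits almost
everywhere. -/
theorem ae_tendsto_integral_σ_radial {u : ℂ → ℝ} (hu : Integrable u m) :
    ∀ᵐ ζ ∂m, Filter.Tendsto (fun r : ℝ => ∫ ξ, u ξ ∂(σ (r * ζ))) (𝓝[<] 1) (𝓝 (u ζ)) := by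
  set U : ℝ → ℝ := fun θ => u (circleMap 0 1 θ) with hU
  have hper : Function.Periodic U (2 * Real.pi) := fun s => by
    simp [hU, periodic_circleMap 0 1 s]
  have hint : ∀ a b, IntervalIntegrable U volume a b := fun a b =>
    hper.intervalIntegrable₀ Real.two_pi_pos.ne' (intervalIntegrable_of_integrable_m hu) a b
  have hloc : LocallyIntegrable U volume := by
    rw [locallyIntegrable_iff]
    intro K hK
    obtain ⟨R, hR⟩ := hK.isBounded.subset_closedBall 0
    rw [Real.closedBall_eq_Icc] at hR
    rcases le_total (0 - R) (0 + R) with h | h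
    · exact ((intervalIntegrable_iff_integrableOn_Icc_of_le h).1 (hint _ _)).mono_set hR
    · refine ((intervalIntegrable_iff_integrableOn_Icc_of_le h).1 (hint _ _)).mono_set
        (hR.trans ?_)
      intro x hx
      exact ⟨by linarith [hx.1, hx.2], by linarith [hx.1, hx.2]⟩
  refine ae_m_of_ae_angle ?_
  filter_upwards [LocallyIntegrable.ae_hasDerivAt_integral hloc] with θ hθ _
  have hd : HasDerivAt (fun t => ∫ s in 0..t, U (θ + s)) (U θ) 0 := by
    have h : HasDerivAt (fun t => ∫ s in θ..(θ + t), U s) (U θ) 0 := by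
      have h1 := hθ θ
      rw [← add_zero θ] at h1
      simpa using h1.comp_const_add θ 0
    simpa [intervalIntegral.integral_comp_add_left] using h
  have hW : ∀ a b, IntervalIntegrable (fun s => U (θ + s)) volume a b := fun a b => by
    have := (hint (θ + a) (θ + b)).comp_add_left θ
    simpa using this
  refine (tendsto_integral_anglePoisson hW hd).congr' ?_
  filter_upwards [Ioo_half_one_mem] with r hr
  exact (integral_σ_radial hu.1 (by linarith [hr.1]) hr.2 θ).symm

/-! ### Taylor coefficients and Parseval's identity -/

/-- The `n`-th Taylor coefficient at the origin. -/
noncomputable def coeff (g : ℂ → ℂ) (n : ℕ) : ℂ := (n.factorial : ℂ)⁻¹ * iteratedDeriv n g 0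

theorem coeff_zero (g : ℂ → ℂ) : coeff g 0 = g 0 := by simp [coeff]

theorem coeff_deriv (g : ℂ → ℂ) (n : ℕ) : coeff (deriv g) n = (n + 1) * coeff g (n + 1) := by
  have h : (n.factorial : ℂ) ≠ 0 := by exact_mod_cast n.factorial_ne_zero
  have h' : (n + 1 : ℂ) ≠ 0 := by exact_mod_cast n.succ_ne_zero
  rw [coeff, coeff, iteratedDeriv_succ', Nat.factorial_succ]
  push_cast
  field_simp

theorem hasSum_coeff {g : ℂ → ℂ} {R : ℝ} (hg : DifferentiableOn ℂ g (Metric.ball 0 R)) {z : ℂ}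
    (hz : z ∈ Metric.ball 0 R) : HasSum (fun n => coeff g n * z ^ n) (g z) := by
  convert! Complex.hasSum_taylorSeries_on_ball hg hz using 2 with n
  rw [coeff, sub_zero, smul_eq_mul, smul_eq_mul]
  ring

theorem hasSum_coeff_deriv {g : ℂ → ℂ} {R : ℝ} (hg : DifferentiableOn ℂ g (Metric.ball 0 R))
    {z : ℂ} (hz : z ∈ Metric.ball 0 R) :
    HasSum (fun n : ℕ => (n + 1) * coeff g (n + 1) * z ^ n) (deriv g z) := by
  simpa [coeff_deriv] using hasSum_coeff (hg.deriv Metric.isOpen_ball) hz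

/-- The polynomial with coefficients `c 0, …, c (N - 1)`. -/
noncomputable def truncation (c : ℕ → ℂ) (N : ℕ) : Polynomial ℂ :=
  ∑ n ∈ Finset.range N, Polynomial.monomial n (c n)

theorem eval_truncation (c : ℕ → ℂ) (N : ℕ) (z : ℂ) :
    (truncation c N).eval z = ∑ n ∈ Finset.range N, c n * z ^ n := by
  simp [truncation, Polynomial.eval_finsetSum]

theorem coeff_truncation (c : ℕ → ℂ) (N n : ℕ) :
    (truncation c N).coeff n = if n < N then c n else 0 := by
  simp [truncation, Polynomial.coeff_monomial]

theorem integrable_m_norm_sq_eval (p : Polynomial ℂ) :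
    Integrable (fun ζ => ‖p.eval ζ‖ ^ 2) m :=
  integrable_m_of_continuousOn (by fun_prop)

/-- **Parseval's identity** for polynomials. -/
theorem integral_m_norm_sq_eval (p : Polynomial ℂ) :
    ∫ ζ, ‖p.eval ζ‖ ^ 2 ∂m = ∑ n ∈ p.support, ‖p.coeff n‖ ^ 2 := by
  rw [integral_m (integrable_m_norm_sq_eval p).1, p.sum_sq_norm_coeff_eq_circleAverage]

theorem integral_m_norm_sq_truncation (c : ℕ → ℂ) (N : ℕ) :
    ∫ ζ, ‖(truncation c N).eval ζ‖ ^ 2 ∂m = ∑ n ∈ Finset.range N, ‖c n‖ ^ 2 := by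
  rw [integral_m_norm_sq_eval]
  have hsub : (truncation c N).support ⊆ Finset.range N := fun n hn => by
    by_contra h
    simp_all [coeff_truncation]
  rw [Finset.sum_subset hsub fun n _ hn => by simpa using hn]
  refine Finset.sum_congr rfl fun n hn => ?_
  rw [coeff_truncation, if_pos (Finset.mem_range.1 hn)]

/-- **Parseval's identity** for absolutely convergent power series on the unit circle. -/
theorem hasSum_norm_sq_of_summable {c : ℕ → ℂ} (hc : Summable fun n => ‖c n‖) {G : ℂ → ℂ}
    (hG : ∀ ζ, ‖ζ‖ = 1 → HasSum (fun n => c n * ζ ^ n) (G ζ)) :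
    HasSum (fun n => ‖c n‖ ^ 2) (∫ ζ, ‖G ζ‖ ^ 2 ∂m) := by
  rw [hasSum_iff_tendsto_nat_of_nonneg fun n => by positivity]
  simp_rw [← integral_m_norm_sq_truncation]
  refine tendsto_integral_of_dominated_convergence (fun _ => (∑' n, ‖c n‖) ^ 2)
    (fun N => (integrable_m_norm_sq_eval _).1) (integrable_const _) (fun N => ?_) ?_
  · filter_upwards [ae_m_norm_eq_one] with ζ hζ
    rw [Real.norm_of_nonneg (by positivity), eval_truncation]
    gcongr
    refine (norm_sum_le _ _).trans ?_
    simp only [norm_mul, norm_pow, hζ, one_pow, mul_one]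
    exact hc.sum_le_tsum _ fun _ _ => norm_nonneg _
  · filter_upwards [ae_m_norm_eq_one] with ζ hζ
    simp_rw [eval_truncation]
    exact ((hG ζ hζ).tendsto_sum_nat.norm).pow 2

/-- **Parseval's identity** on circles inside the domain of holomorphy. -/
theorem hasSum_norm_sq_coeff {g : ℂ → ℂ} {R : ℝ} (hg : DifferentiableOn ℂ g (Metric.ball 0 R))
    {r : ℝ} (h0 : 0 ≤ r) (hr : r < R) :
    HasSum (fun n => ‖coeff g n‖ ^ 2 * r ^ (2 * n)) (∫ ζ, ‖g (r * ζ)‖ ^ 2 ∂m) := by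
  have hs : Summable fun n => ‖coeff g n * (r : ℂ) ^ n‖ :=
    (hasSum_coeff hg (z := r) (by simpa [abs_of_nonneg h0] using hr)).summable.norm
  have h := hasSum_norm_sq_of_summable hs (G := fun ζ => g (r * ζ)) fun ζ hζ => by
    simpa [mul_pow, mul_assoc] using
      hasSum_coeff hg (z := r * ζ) (by simpa [abs_of_nonneg h0, hζ] using hr)
  convert! h using 2 with n
  rw [norm_mul, norm_pow, Complex.norm_real, Real.norm_of_nonneg h0]
  ring

/-! ### The Littlewood–Paley identity with pole at the origin -/

/-- Matches the angular range of the polar coordinates on `ℂ`: two periods are fundamental domains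
of the same translation group, and an endpoint is null. -/
theorem lintegral_m_eq_Ioo {u : ℂ → ℝ≥0∞} (hu : Measurable u) :
    ∫⁻ ζ, u ζ ∂m = ENNReal.ofReal (2 * Real.pi)⁻¹ *
      ∫⁻ θ in Set.Ioo (-Real.pi) Real.pi, u (circleMap 0 1 θ) := by
  rw [lintegral_m hu]
  congr 1
  have h1 := isAddFundamentalDomain_Ioc Real.two_pi_pos 0
  have h2 := isAddFundamentalDomain_Ioc Real.two_pi_pos (-Real.pi)
  have h := h1.setLIntegral_eq h2 (fun θ => u (circleMap 0 1 θ)) fun g θ => by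
    obtain ⟨_, k, rfl⟩ := g
    simp only [AddSubgroup.vadd_def, vadd_eq_add]
    rw [add_comm, (periodic_circleMap 0 1).zsmul k θ]
  rw [zero_add, show -Real.pi + 2 * Real.pi = Real.pi by ring] at h
  rw [h, setLIntegral_congr Ioo_ae_eq_Ioc]

theorem measurableSet_disc : MeasurableSet disc := Metric.isOpen_ball.measurableSet

/-- Integration over the disc in polar coordinates. -/
theorem lintegral_area_eq_polar {H : ℂ → ℝ≥0∞} (hH : Measurable H) :
    ∫⁻ z, H z ∂area =
      ∫⁻ r in Set.Ioo (0 : ℝ) 1, ENNReal.ofReal (2 * r) * ∫⁻ ζ, H (r * ζ) ∂m := by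
  have hpt : ∀ p : ℝ × ℝ, Complex.polarCoord.symm p = p.1 * circleMap 0 1 p.2 := fun p => by
    simp [circleMap, Complex.exp_mul_I]
  have hi : Measurable (disc.indicator H) := hH.indicator measurableSet_disc
  have hmeas : Measurable fun p : ℝ × ℝ =>
      ENNReal.ofReal p.1 * disc.indicator H (p.1 * circleMap 0 1 p.2) := by
    refine (by fun_prop : Measurable fun p : ℝ × ℝ => ENNReal.ofReal p.1).mul (hi.comp ?_)
    fun_prop
  rw [area, lintegral_smul_measure, ← lintegral_indicator measurableSet_disc,
    ← Complex.lintegral_comp_polarCoord_symm, polarCoord_target, Measure.volume_eq_prod,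
    ← Measure.prod_restrict]
  simp only [smul_eq_mul, hpt]
  rw [lintegral_prod _ hmeas.aemeasurable, ← lintegral_const_mul _ hmeas.lintegral_prod_right',
    ← lintegral_indicator measurableSet_Ioi, ← lintegral_indicator measurableSet_Ioo]
  refine lintegral_congr fun r => ?_
  by_cases h0 : 0 < r
  · rw [Set.indicator_of_mem (by exact h0)]
    by_cases h1 : r < 1
    · rw [Set.indicator_of_mem (show r ∈ Set.Ioo (0 : ℝ) 1 from ⟨h0, h1⟩), lintegral_m_eq_Ioo (by fun_prop)]
      have : ∀ θ, disc.indicator H (r * circleMap 0 1 θ) = H (r * circleMap 0 1 θ) := fun θ =>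
        Set.indicator_of_mem (radial_mem_disc h0 h1 (by simp)) _
      simp only [this]
      rw [lintegral_const_mul _ (by fun_prop), ← mul_assoc, ← mul_assoc, ← ENNReal.ofReal_mul (by positivity),
        ← ENNReal.ofReal_mul (by positivity)]
      congr 2
      field_simp
    · rw [Set.indicator_of_notMem fun h => h1 h.2]
      have : ∀ θ, disc.indicator H (r * circleMap 0 1 θ) = 0 := fun θ =>
        Set.indicator_of_notMem (by simpa [disc, abs_of_pos h0] using h1) _
      simp [this]
  · rw [Set.indicator_of_notMem (by simpa using h0), Set.indicator_of_notMem fun h => h0 h.1]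

/-- This normalization makes the weight of each coefficient exactly one in the Littlewood–Paley
identity: the factor `(n + 1)²` comes from differentiating `z ^ (n + 1)`. -/
theorem lintegral_pow_mul_log (n : ℕ) :
    ∫⁻ r in Set.Ioo (0 : ℝ) 1, ENNReal.ofReal (2 * r) *
      (ENNReal.ofReal (-Real.log (r ^ 2)) * ENNReal.ofReal ((n + 1) ^ 2 * r ^ (2 * n))) = 1 := by
  -- An explicit antiderivative of the integrand on `(0, 1)`. The logarithms are grouped as `r * log
  -- r`, which is continuous at `0`, so that the fundamental theorem applies on the closed interval.
  set Φ : ℝ → ℝ := fun r => -2 * (n + 1) * (r ^ (2 * n + 1) * (r * Real.log r)) + r ^ (2 * n + 2)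
    with hΦ
  set φ : ℝ → ℝ := fun r => -4 * (n + 1) ^ 2 * (r ^ (2 * n) * (r * Real.log r)) with hφ
  have hcΦ : Continuous Φ := by
    have := Real.continuous_mul_log
    fun_prop
  have hcφ : Continuous φ := by
    have := Real.continuous_mul_log
    fun_prop
  have hder : ∀ r ∈ Set.Ioo (0 : ℝ) 1, HasDerivAt Φ (φ r) r := by
    intro r hr
    have h1 := ((hasDerivAt_pow (2 * n + 1) r).mul
      ((hasDerivAt_id r).mul (Real.hasDerivAt_log hr.1.ne'))).const_mul (-2 * (n + 1 : ℝ))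
    convert! h1.add (hasDerivAt_pow (2 * n + 2) r) using 1
    have := hr.1.ne'
    simp only [hφ, Pi.mul_apply, id, show 2 * n + 1 - 1 = 2 * n by omega,
      show 2 * n + 2 - 1 = 2 * n + 1 by omega]
    push_cast
    field_simp
    ring
  have hint : ∫ r in (0 : ℝ)..1, φ r = 1 := by
    rw [intervalIntegral.integral_eq_sub_of_hasDerivAt_of_le zero_le_one hcΦ.continuousOn hder
      (hcφ.intervalIntegrable _ _)]
    simp [hΦ]
  have hnn : ∀ r ∈ Set.Ioo (0 : ℝ) 1, 0 ≤ φ r := by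
    intro r hr
    have : Real.log r ≤ 0 := Real.log_nonpos hr.1.le hr.2.le
    have h2 : r * Real.log r ≤ 0 := mul_nonpos_of_nonneg_of_nonpos hr.1.le this
    have h3 : r ^ (2 * n) * (r * Real.log r) ≤ 0 :=
      mul_nonpos_of_nonneg_of_nonpos (pow_nonneg hr.1.le _) h2
    simp only [hφ]
    nlinarith [mul_nonneg (sq_nonneg (n + 1 : ℝ)) (neg_nonneg.2 h3)]
  rw [setLIntegral_congr_fun (g := fun r => ENNReal.ofReal (φ r)) measurableSet_Ioo,
    ← ofReal_integral_eq_lintegral_ofReal, ← integral_Ioc_eq_integral_Ioo,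
    ← intervalIntegral.integral_of_le zero_le_one, hint, ENNReal.ofReal_one]
  · exact (hcφ.integrableOn_Icc (a := 0) (b := 1)).mono_set Set.Ioo_subset_Icc_self
  · exact (ae_restrict_iff' measurableSet_Ioo).2 (.of_forall hnn)
  · intro r hr
    have : 0 ≤ -Real.log (r ^ 2) := by
      have := Real.log_nonpos hr.1.le hr.2.le
      rw [Real.log_pow]; push_cast; linarith
    have h2 : 0 ≤ 2 * r := by linarith [hr.1]
    simp only
    rw [← ENNReal.ofReal_mul this, ← ENNReal.ofReal_mul h2]
    congr 1
    simp only [hφ, Real.log_pow]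
    push_cast
    ring

/-- **Littlewood–Paley identity** at the origin. -/
theorem lintegral_deriv_sq_log {g : ℂ → ℂ} (hg : DifferentiableOn ℂ g disc) :
    ∫⁻ z, ENNReal.ofReal (‖deriv g z‖ ^ 2) * ENNReal.ofReal (-Real.log (‖z‖ ^ 2)) ∂area =
      ∑' n, ENNReal.ofReal (‖coeff g (n + 1)‖ ^ 2) := by
  have hd : Measurable (deriv g) := measurable_deriv g
  rw [lintegral_area_eq_polar (by fun_prop)]
  have hcircle : ∀ r ∈ Set.Ioo (0 : ℝ) 1,
      ENNReal.ofReal (2 * r) * ∫⁻ ζ, ENNReal.ofReal (‖deriv g (r * ζ)‖ ^ 2) *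
        ENNReal.ofReal (-Real.log (‖(r * ζ : ℂ)‖ ^ 2)) ∂m =
      ∑' n : ℕ, ENNReal.ofReal (‖coeff g (n + 1)‖ ^ 2) * (ENNReal.ofReal (2 * r) *
        (ENNReal.ofReal (-Real.log (r ^ 2)) * ENNReal.ofReal ((n + 1) ^ 2 * r ^ (2 * n)))) := by
    intro r hr
    have hP := hasSum_norm_sq_coeff (hg.deriv Metric.isOpen_ball) hr.1.le hr.2
    have hint : Integrable (fun ζ => ‖deriv g (r * ζ)‖ ^ 2) m := by
      refine integrable_m_of_continuousOn (ContinuousOn.pow (ContinuousOn.norm ?_) 2)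
      refine ((hg.deriv Metric.isOpen_ball).continuousOn).comp (by fun_prop) fun ζ hζ => ?_
      exact radial_mem_disc hr.1 hr.2 (by simpa using hζ)
    have h1 : ∫⁻ ζ, ENNReal.ofReal (‖deriv g (r * ζ)‖ ^ 2) *
        ENNReal.ofReal (-Real.log (‖(r * ζ : ℂ)‖ ^ 2)) ∂m =
        ENNReal.ofReal (∫ ζ, ‖deriv g (r * ζ)‖ ^ 2 ∂m) * ENNReal.ofReal (-Real.log (r ^ 2)) := by
      rw [ofReal_integral_eq_lintegral_ofReal hint (.of_forall fun _ => by positivity),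
        ← lintegral_mul_const _ (by fun_prop)]
      refine lintegral_congr_ae ?_
      filter_upwards [ae_m_norm_eq_one] with ζ hζ
      simp [hζ]
    rw [h1, ← hP.tsum_eq, ENNReal.ofReal_tsum_of_nonneg
      (fun n => mul_nonneg (by positivity) (pow_nonneg hr.1.le _)) hP.summable,
      ← ENNReal.tsum_mul_right, ← ENNReal.tsum_mul_left]
    refine tsum_congr fun n => ?_
    have : ENNReal.ofReal (‖coeff (deriv g) n‖ ^ 2 * r ^ (2 * n)) =
        ENNReal.ofReal (‖coeff g (n + 1)‖ ^ 2) * ENNReal.ofReal ((n + 1) ^ 2 * r ^ (2 * n)) := by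
      rw [← ENNReal.ofReal_mul (by positivity), coeff_deriv, norm_mul,
        show ‖(n + 1 : ℂ)‖ = n + 1 by exact_mod_cast Complex.norm_natCast (n + 1)]
      congr 1
      ring
    rw [this]
    ring
  rw [setLIntegral_congr_fun measurableSet_Ioo hcircle, lintegral_tsum fun n => by fun_prop]
  refine tsum_congr fun n => ?_
  rw [lintegral_const_mul _ (by fun_prop), lintegral_pow_mul_log, mul_one]

/-! ### Disc automorphisms and the Littlewood–Paley identity for polynomials -/

/-- The involutive automorphism of the unit disc exchanging `0` and `w`. -/
noncomputable def mobius (w z : ℂ) : ℂ := (w - z) / (1 - conj w * z)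

theorem one_sub_conj_mul_ne_zero {w z : ℂ} (h : ‖w‖ * ‖z‖ < 1) : 1 - conj w * z ≠ 0 := by
  intro h0
  have : ‖conj w * z‖ = 1 := by rw [← sub_eq_zero.1 h0, norm_one]
  rw [norm_mul, RCLike.norm_conj] at this
  linarith

theorem norm_lt_one_of_mem_disc {w : ℂ} (hw : w ∈ disc) : ‖w‖ < 1 := by simpa [disc] using hw

theorem norm_mul_norm_lt_one {w z : ℂ} (hw : w ∈ disc) (hz : ‖z‖ ≤ 1) : ‖w‖ * ‖z‖ < 1 := by
  have := norm_lt_one_of_mem_disc hw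
  nlinarith [norm_nonneg z, norm_nonneg w]

theorem norm_one_sub_conj_mul_sq (w z : ℂ) :
    ‖1 - conj w * z‖ ^ 2 - ‖w - z‖ ^ 2 = (1 - ‖w‖ ^ 2) * (1 - ‖z‖ ^ 2) := by
  simp only [← Complex.normSq_eq_norm_sq, Complex.normSq_apply]
  simp
  ring

theorem one_sub_norm_mobius_sq {w z : ℂ} (h : 1 - conj w * z ≠ 0) :
    1 - ‖mobius w z‖ ^ 2 = (1 - ‖w‖ ^ 2) * (1 - ‖z‖ ^ 2) / ‖1 - conj w * z‖ ^ 2 := by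
  have h' : ‖1 - conj w * z‖ ≠ 0 := norm_ne_zero_iff.2 h
  rw [← norm_one_sub_conj_mul_sq, mobius, norm_div, div_pow, eq_div_iff (pow_ne_zero 2 h'), sub_mul,
    div_mul_cancel₀ _ (pow_ne_zero 2 h')]
  ring

theorem mobius_mem_disc {w z : ℂ} (hw : w ∈ disc) (hz : z ∈ disc) : mobius w z ∈ disc := by
  have h1 := norm_lt_one_of_mem_disc hw
  have h2 := norm_lt_one_of_mem_disc hz
  have h := one_sub_norm_mobius_sq (one_sub_conj_mul_ne_zero (norm_mul_norm_lt_one hw h2.le))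
  have h3 : 0 < ‖1 - conj w * z‖ :=
    norm_pos_iff.2 (one_sub_conj_mul_ne_zero (norm_mul_norm_lt_one hw h2.le))
  have h4 : 0 < 1 - ‖w‖ ^ 2 := by nlinarith [norm_nonneg w]
  have h5 : 0 < 1 - ‖z‖ ^ 2 := by nlinarith [norm_nonneg z]
  have : 0 < 1 - ‖mobius w z‖ ^ 2 := by rw [h]; positivity
  simp only [disc, Metric.mem_ball, dist_zero_right]
  nlinarith [norm_nonneg (mobius w z)]

theorem norm_mobius_eq_one {w z : ℂ} (hw : w ∈ disc) (hz : ‖z‖ = 1) : ‖mobius w z‖ = 1 := by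
  have h := one_sub_norm_mobius_sq (one_sub_conj_mul_ne_zero (norm_mul_norm_lt_one hw hz.le))
  rw [hz] at h
  norm_num at h
  nlinarith [norm_nonneg (mobius w z), sq_nonneg (‖mobius w z‖ - 1)]

theorem mobius_mobius {w z : ℂ} (hw : w ∈ disc) (hz : z ∈ disc) : mobius w (mobius w z) = z := by
  have h1 : 1 - conj w * z ≠ 0 :=
    one_sub_conj_mul_ne_zero (norm_mul_norm_lt_one hw (norm_lt_one_of_mem_disc hz).le)
  have h2 : 1 - conj w * mobius w z ≠ 0 := one_sub_conj_mul_ne_zero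
    (norm_mul_norm_lt_one hw (norm_lt_one_of_mem_disc (mobius_mem_disc hw hz)).le)
  have h3 : mobius w z * (1 - conj w * z) = w - z := div_mul_cancel₀ _ h1
  rw [mobius, div_eq_iff h2]
  linear_combination -h3

theorem mobius_zero (w : ℂ) : mobius w 0 = w := by simp [mobius]

theorem image_mobius_disc {w : ℂ} (hw : w ∈ disc) : mobius w '' disc = disc := by
  refine Set.Subset.antisymm (Set.image_subset_iff.2 fun z hz => mobius_mem_disc hw hz)
    fun z hz => ⟨mobius w z, mobius_mem_disc hw hz, mobius_mobius hw hz⟩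

theorem injOn_mobius {w : ℂ} (hw : w ∈ disc) : Set.InjOn (mobius w) disc := fun a ha b hb h => by
  rw [← mobius_mobius hw ha, h, mobius_mobius hw hb]

theorem differentiableAt_mobius {w z : ℂ} (h : ‖w‖ * ‖z‖ < 1) :
    DifferentiableAt ℂ (mobius w) z := by
  unfold mobius
  exact DifferentiableAt.fun_div (by fun_prop) (by fun_prop) (one_sub_conj_mul_ne_zero h)

@[fun_prop]
theorem measurable_mobius (w : ℂ) : Measurable (mobius w) := by
  unfold mobius; fun_prop

/-- Conformal invariance of the Green kernel: the automorphism is an involution, so the quotient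
inside the logarithm is, in modulus, the inverse of `mobius w (mobius w z) = z`. -/
theorem greenKernel_mobius {w z : ℂ} (hw : w ∈ disc) (hz : z ∈ disc) (h0 : z ≠ 0) :
    greenKernel (mobius w z) w = ENNReal.ofReal (-Real.log (‖z‖ ^ 2)) := by
  have hne : mobius w z ≠ w := fun h => h0 <| injOn_mobius hw hz
    (by simp [disc] : (0 : ℂ) ∈ disc) (by rw [h, mobius_zero])
  rw [greenKernel, if_neg hne]
  have : ‖(1 - conj w * mobius w z) / (mobius w z - w)‖ = ‖z‖⁻¹ := by
    rw [← norm_neg, ← div_neg, neg_sub]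
    conv_rhs => rw [← mobius_mobius hw hz, mobius, ← norm_inv, inv_div]
  rw [this, inv_pow, Real.log_inv]

/-- Conformal change of variables in weighted Dirichlet integrals. -/
theorem lintegral_deriv_sq_greenKernel {f : ℂ → ℂ} (hf : DifferentiableOn ℂ f disc) {w : ℂ}
    (hw : w ∈ disc) :
    ∫⁻ z, ENNReal.ofReal (‖deriv f z‖ ^ 2) * greenKernel z w ∂area =
      ∫⁻ z, ENNReal.ofReal (‖deriv (fun z => f (mobius w z)) z‖ ^ 2) *
        ENNReal.ofReal (-Real.log (‖z‖ ^ 2)) ∂area := by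
  rw [area, lintegral_smul_measure, lintegral_smul_measure]
  congr 1
  have hd : ∀ z ∈ disc, DifferentiableAt ℂ (mobius w) z := fun z hz =>
    differentiableAt_mobius (norm_mul_norm_lt_one hw (norm_lt_one_of_mem_disc hz).le)
  have hF : ∀ z ∈ disc, HasFDerivWithinAt (mobius w)
      ((ContinuousLinearMap.toSpanSingleton ℂ (deriv (mobius w) z)).restrictScalars ℝ) disc z :=
    fun z hz => ((hd z hz).hasDerivAt.hasFDerivAt.restrictScalars ℝ).hasFDerivWithinAt
  have hcv := lintegral_image_eq_lintegral_abs_det_fderiv_mul volume measurableSet_disc hF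
    (injOn_mobius hw) fun z => ENNReal.ofReal (‖deriv f z‖ ^ 2) * greenKernel z w
  rw [image_mobius_disc hw] at hcv
  rw [hcv]
  refine lintegral_congr_ae ?_
  -- The origin is sent to the pole, where the Green kernel is `∞` while the convention `Real.log 0
  -- = 0` makes the other weight vanish; a single point is null.
  have hne : ∀ᵐ z ∂(volume.restrict disc), z ≠ (0 : ℂ) :=
    ae_restrict_of_ae (by simp [ae_iff])
  filter_upwards [ae_restrict_mem measurableSet_disc, hne] with z hz h0
  have hchain : deriv (fun z => f (mobius w z)) z =
      deriv f (mobius w z) * deriv (mobius w) z :=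
    deriv_comp z (hf.differentiableAt (Metric.isOpen_ball.mem_nhds (mobius_mem_disc hw hz)))
      (hd z hz)
  -- Multiplication by a complex number has real determinant equal to its squared modulus, which is
  -- the factor produced by the chain rule.
  have hdet : |((ContinuousLinearMap.toSpanSingleton ℂ
      (deriv (mobius w) z)).restrictScalars ℝ).det| = ‖deriv (mobius w) z‖ ^ 2 := by
    simp [ContinuousLinearMap.det, LinearMap.det_restrictScalars, Algebra.norm_complex_eq,
      Complex.normSq_eq_norm_sq]
  rw [greenKernel_mobius hw hz h0, hchain, hdet, ← mul_assoc, ← ENNReal.ofReal_mul (by positivity),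
    norm_mul, mul_pow, mul_comm (‖deriv (mobius w) z‖ ^ 2)]

/-- The integral of `‖p‖ ^ 2` over the circle is determined by the analytic moments. -/
theorem integral_norm_sq_eval_of_moments {ν : Measure ℂ} [IsFiniteMeasure ν]
    (hν : ∀ᵐ ζ ∂ν, ‖ζ‖ = 1) {w : ℂ} (hmom : ∀ k : ℕ, ∫ ζ, ζ ^ k ∂ν = w ^ k) (p : Polynomial ℂ) :
    ((∫ ζ, ‖p.eval ζ‖ ^ 2 ∂ν : ℝ) : ℂ) =
      ∑ i ∈ Finset.range (p.natDegree + 1), ∑ j ∈ Finset.range (p.natDegree + 1),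
        p.coeff i * conj (p.coeff j) * if j ≤ i then w ^ (i - j) else conj (w ^ (j - i)) := by
  have hmix : ∀ i j : ℕ, ∫ ζ, ζ ^ i * conj (ζ ^ j) ∂ν =
      if j ≤ i then w ^ (i - j) else conj (w ^ (j - i)) := by
    intro i j
    -- On the circle `ζ * conj ζ = 1`, so the smaller power cancels and a pure moment or its
    -- conjugate remains.
    split_ifs with h
    · rw [← hmom]
      refine integral_congr_ae ?_
      filter_upwards [hν] with ζ hζ
      conv_lhs => rw [← Nat.sub_add_cancel h, pow_add, mul_assoc, Complex.mul_conj,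
        Complex.normSq_eq_norm_sq, norm_pow, hζ]
      simp
    · rw [← hmom, ← integral_conj]
      refine integral_congr_ae ?_
      filter_upwards [hν] with ζ hζ
      conv_lhs => rw [← Nat.sub_add_cancel (not_le.1 h).le, pow_add, map_mul, mul_left_comm,
        Complex.mul_conj, Complex.normSq_eq_norm_sq, norm_pow, hζ]
      simp
  have hint : ∀ (a : ℂ) (i j : ℕ), Integrable (fun ζ : ℂ => a * (ζ ^ i * conj (ζ ^ j))) ν := by
    intro a i j
    refine Integrable.of_bound (C := ‖a‖) (Continuous.aestronglyMeasurable (by fun_prop)) ?_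
    filter_upwards [hν] with ζ hζ
    simp [hζ]
  have hexp : ∀ ζ : ℂ, ((‖p.eval ζ‖ ^ 2 : ℝ) : ℂ) =
      ∑ i ∈ Finset.range (p.natDegree + 1), ∑ j ∈ Finset.range (p.natDegree + 1),
        p.coeff i * conj (p.coeff j) * (ζ ^ i * conj (ζ ^ j)) := by
    intro ζ
    rw [← Complex.normSq_eq_norm_sq, ← Complex.mul_conj, p.eval_eq_sum_range, map_sum,
      Finset.sum_mul_sum]
    refine Finset.sum_congr rfl fun i _ => Finset.sum_congr rfl fun j _ => ?_
    rw [map_mul]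
    ring
  rw [← integral_complex_ofReal]
  simp_rw [hexp]
  rw [integral_finsetSum _ fun i _ => integrable_finsetSum _ fun j _ => hint _ i j]
  refine Finset.sum_congr rfl fun i _ => ?_
  rw [integral_finsetSum _ fun j _ => hint _ i j]
  refine Finset.sum_congr rfl fun j _ => ?_
  rw [integral_const_mul, hmix]

theorem diffContOnCl_mobius {w : ℂ} (hw : w ∈ disc) :
    DiffContOnCl ℂ (mobius w) (Metric.ball 0 1) := by
  refine DifferentiableOn.diffContOnCl fun z hz => ?_
  rw [closure_ball _ one_ne_zero] at hz
  exact (differentiableAt_mobius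
    (norm_mul_norm_lt_one hw (by simpa using hz))).differentiableWithinAt

/-- The image of `m` under the automorphism and the harmonic measure `σ w` both live on the circle
and both have moments `w ^ k`, by the mean value property and the Poisson formula respectively.
These moments determine the integral of `‖p‖²`. -/
theorem integral_norm_sq_eval_mobius (p : Polynomial ℂ) {w : ℂ} (hw : w ∈ disc) :
    ∫ ζ, ‖p.eval (mobius w ζ)‖ ^ 2 ∂m = ∫ ζ, ‖p.eval ζ‖ ^ 2 ∂(σ w) := by
  have hprob := isProbabilityMeasure_σ hw
  have hmap : IsFiniteMeasure (m.map (mobius w)) := inferInstance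
  have h1 := integral_norm_sq_eval_of_moments (ν := m.map (mobius w)) (w := w)
    ((ae_map_iff (by fun_prop) (measurableSet_eq_fun (by fun_prop) (by fun_prop))).2 (by
      filter_upwards [ae_m_norm_eq_one] with ζ hζ using norm_mobius_eq_one hw hζ))
    (fun k => by
      rw [integral_map (by fun_prop) (Continuous.aestronglyMeasurable (by fun_prop)),
        integral_m (Measurable.aestronglyMeasurable (by fun_prop))]
      have hd : DiffContOnCl ℂ (fun z => mobius w z ^ k) (Metric.ball 0 |1|) := by
        rw [abs_one]
        exact (differentiable_pow k).comp_diffContOnCl (diffContOnCl_mobius hw)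
      rw [hd.circleAverage, mobius_zero]) p
  have h2 := integral_norm_sq_eval_of_moments (ν := σ w) (w := w)
    ((σ_absolutelyContinuous w).ae_le ae_m_norm_eq_one)
    (fun k => integral_σ_of_diffContOnCl (differentiable_pow k).diffContOnCl hw) p
  rw [integral_map (by fun_prop) (Continuous.aestronglyMeasurable (by fun_prop))] at h1
  exact_mod_cast h1.trans h2.symm

/-- **Littlewood–Paley identity** for polynomials, with an arbitrary pole. -/
theorem lintegral_deriv_sq_greenKernel_eval (p : Polynomial ℂ) {w : ℂ} (hw : w ∈ disc) :
    ∫⁻ z, ENNReal.ofReal (‖deriv (fun z => p.eval z) z‖ ^ 2) * greenKernel z w ∂area =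
      ENNReal.ofReal (∫ ζ, ‖p.eval ζ‖ ^ 2 ∂(σ w) - ‖p.eval w‖ ^ 2) := by
  set g : ℂ → ℂ := fun z => p.eval (mobius w z) with hg
  have hw1 := norm_lt_one_of_mem_disc hw
  -- This radius satisfies `R > 1` and `‖w‖ * R < 1`, so the composition is holomorphic beyond the
  -- closed disc and Parseval's identity applies on the unit circle itself.
  set R : ℝ := 2 / (1 + ‖w‖) with hR
  have hR1 : 1 < R := by rw [hR, lt_div_iff₀ (by positivity)]; linarith
  have hgd : DifferentiableOn ℂ g (Metric.ball 0 R) := fun z hz => by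
    have hz' : ‖z‖ < R := by simpa using hz
    have : ‖w‖ * ‖z‖ < 1 := by
      rw [hR, lt_div_iff₀ (by positivity)] at hz'
      nlinarith [norm_nonneg z, norm_nonneg w]
    exact (p.differentiable.differentiableAt.comp z
      (differentiableAt_mobius this)).differentiableWithinAt
  have hgd' : DifferentiableOn ℂ g disc := hgd.mono (Metric.ball_subset_ball hR1.le)
  have hP := hasSum_norm_sq_coeff hgd zero_le_one hR1
  simp only [one_pow, mul_one, Complex.ofReal_one, one_mul] at hP
  -- Removing the constant coefficient subtracts `‖g 0‖² = ‖p(w)‖²`.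
  have hP' := (hasSum_nat_add_iff' 1).2 hP
  simp only [Finset.range_one, Finset.sum_singleton, coeff_zero] at hP'
  rw [lintegral_deriv_sq_greenKernel p.differentiable.differentiableOn hw,
    lintegral_deriv_sq_log hgd', ← ENNReal.ofReal_tsum_of_nonneg (fun n => by positivity)
      hP'.summable, hP'.tsum_eq, hg]
  simp only [mobius_zero]
  rw [integral_norm_sq_eval_mobius p hw]

/-! ### Convergence of `L²` norms -/

theorem eLpNorm_two_sq {α : Type*} [MeasurableSpace α] (ν : Measure α) (u : α → ℂ) :
    eLpNorm u 2 ν ^ 2 = ∫⁻ x, ENNReal.ofReal (‖u x‖ ^ 2) ∂ν := by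
  have h := eLpNorm_nnreal_pow_eq_lintegral (p := 2) (f := u) (μ := ν) two_ne_zero
  norm_num at h
  rw [h]
  refine lintegral_congr fun x => ?_
  rw [← ofReal_norm, ENNReal.ofReal_pow (norm_nonneg _)]

/-- The triangle inequality in `ℝ≥0∞`; no norm is assumed finite, so it applies to `deriv f` before
its weighted norm is known to be finite. -/
theorem tendsto_eLpNorm_of_tendsto_sub {α : Type*} [MeasurableSpace α] {ν : Measure α}
    {u : ℕ → α → ℂ} {v : α → ℂ} (hu : ∀ n, AEStronglyMeasurable (u n) ν)
    (hv : AEStronglyMeasurable v ν)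
    (h : Filter.Tendsto (fun n => eLpNorm (u n - v) 2 ν) Filter.atTop (𝓝 0)) :
    Filter.Tendsto (fun n => eLpNorm (u n) 2 ν) Filter.atTop (𝓝 (eLpNorm v 2 ν)) := by
  have hlow : Filter.Tendsto (fun n => eLpNorm v 2 ν - eLpNorm (u n - v) 2 ν) Filter.atTop
      (𝓝 (eLpNorm v 2 ν)) := by
    simpa using ENNReal.Tendsto.sub tendsto_const_nhds h (Or.inr ENNReal.zero_ne_top)
  have hup : Filter.Tendsto (fun n => eLpNorm v 2 ν + eLpNorm (u n - v) 2 ν) Filter.atTop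
      (𝓝 (eLpNorm v 2 ν)) := by
    simpa using tendsto_const_nhds.add h
  refine tendsto_of_tendsto_of_tendsto_of_le_of_le hlow hup (fun n => ?_) fun n => ?_
  · rw [tsub_le_iff_right]
    calc eLpNorm v 2 ν = eLpNorm (u n - (u n - v)) 2 ν := by simp
      _ ≤ _ := eLpNorm_sub_le (hu n) ((hu n).sub hv) (by norm_num)
  · calc eLpNorm (u n) 2 ν = eLpNorm (v + (u n - v)) 2 ν := by simp
      _ ≤ _ := eLpNorm_add_le hv ((hu n).sub hv) (by norm_num)

/-! ### Boundary functions of `H²` functions -/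

theorem memLp_eval (p : Polynomial ℂ) : MemLp (fun ζ => p.eval ζ) 2 m := by
  refine (memLp_two_iff_integrable_sq_norm p.continuous.aestronglyMeasurable).2 ?_
  exact integrable_m_norm_sq_eval p

theorem eLpNorm_m_truncation_sub_sq (c : ℕ → ℂ) {M N : ℕ} (h : M ≤ N) :
    eLpNorm ((fun ζ => (truncation c N).eval ζ) - fun ζ => (truncation c M).eval ζ) 2 m ^ 2 =
      ENNReal.ofReal (∑ n ∈ Finset.range N, ‖c n‖ ^ 2 - ∑ n ∈ Finset.range M, ‖c n‖ ^ 2) := by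
  set d : ℕ → ℂ := fun n => if n < M then 0 else c n with hd
  have hpoly : ((fun ζ => (truncation c N).eval ζ) - fun ζ => (truncation c M).eval ζ) =
      fun ζ => (truncation d N).eval ζ := by
    funext ζ
    simp only [Pi.sub_apply, eval_truncation]
    rw [← Finset.sum_range_add_sum_Ico _ h, add_sub_cancel_left,
      ← Finset.sum_range_add_sum_Ico (fun n => d n * ζ ^ n) h,
      Finset.sum_eq_zero (s := Finset.range M), zero_add]
    · exact Finset.sum_congr rfl fun n hn => by
        simp [hd, not_lt.2 (Finset.mem_Ico.1 hn).1]
    · intro n hn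
      simp [hd, Finset.mem_range.1 hn]
  rw [hpoly, eLpNorm_two_sq, ← ofReal_integral_eq_lintegral_ofReal (integrable_m_norm_sq_eval _)
    (.of_forall fun _ => by positivity), integral_m_norm_sq_truncation]
  congr 1
  rw [← Finset.sum_range_add_sum_Ico _ h, ← Finset.sum_range_add_sum_Ico (fun n => ‖c n‖ ^ 2) h,
    add_sub_cancel_left, Finset.sum_eq_zero (s := Finset.range M), zero_add]
  · exact Finset.sum_congr rfl fun n hn => by
      simp [hd, not_lt.2 (Finset.mem_Ico.1 hn).1]
  · intro n hn
    simp [hd, Finset.mem_range.1 hn]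

/-- Square summable power series converge in `L²` of the circle. -/
theorem exists_tendsto_truncation {c : ℕ → ℂ} (hc : Summable fun n => ‖c n‖ ^ 2) :
    ∃ u : ℂ → ℂ, MemLp u 2 m ∧ Filter.Tendsto
      (fun N => eLpNorm ((fun ζ => (truncation c N).eval ζ) - u) 2 m) Filter.atTop (𝓝 0) := by
  set S : ℕ → ℝ := fun N => ∑ n ∈ Finset.range N, ‖c n‖ ^ 2 with hS
  set L : ℝ := ∑' n, ‖c n‖ ^ 2 with hL
  have hSL : Filter.Tendsto S Filter.atTop (𝓝 L) := hc.hasSum.tendsto_sum_nat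
  have hSle : ∀ N, S N ≤ L := fun N => hc.sum_le_tsum _ fun _ _ => by positivity
  have hmono : Monotone S := fun M N h =>
    Finset.sum_le_sum_of_subset_of_nonneg (Finset.range_mono h) fun _ _ _ => by positivity
  set P : ℕ → Lp ℂ 2 m := fun N => (memLp_eval (truncation c N)).toLp _ with hP
  have hdist : ∀ M N, M ≤ N → dist (P N) (P M) ≤ √(L - S M) := by
    intro M N h
    refine Real.le_sqrt_of_sq_le ?_
    rw [dist_eq_norm, hP, ← MemLp.toLp_sub, Lp.norm_toLp, ← ENNReal.toReal_pow,
      eLpNorm_m_truncation_sub_sq c h, ENNReal.toReal_ofReal (sub_nonneg.2 (hmono h))]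
    linarith [hSle N]
  have hcau : CauchySeq P := by
    refine cauchySeq_of_le_tendsto_0 (fun N => √(L - S N) + √(L - S N)) (fun n k N hn hk => ?_) ?_
    · refine (dist_triangle _ (P N) _).trans (add_le_add (hdist N n hn) ?_)
      rw [dist_comm]
      exact hdist N k hk
    · have h0 : Filter.Tendsto (fun N => √(L - S N)) Filter.atTop (𝓝 0) := by
        simpa using (hSL.const_sub L).sqrt
      simpa using h0.add h0
  obtain ⟨u, hu⟩ := cauchySeq_tendsto_of_complete hcau
  refine ⟨u, Lp.memLp u, ?_⟩
  rw [Lp.tendsto_Lp_iff_tendsto_eLpNorm'] at hu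
  refine hu.congr fun N => eLpNorm_congr_ae ?_
  filter_upwards [(memLp_eval (truncation c N)).coeFn_toLp] with ζ hζ
  simp [hP, hζ]

/-- Parseval's identity at radius `r` bounds every finite partial sum by the Hardy constant; in a
finite sum `r` may tend to `1`. -/
theorem summable_norm_sq_coeff {f : ℂ → ℂ} (hf : MemHardy 2 f) :
    Summable fun n => ‖coeff f n‖ ^ 2 := by
  obtain ⟨hd, C, hC⟩ := hf
  refine summable_of_sum_le (c := C) (fun n => by positivity) fun s => ?_
  have hr : ∀ r ∈ Set.Ioo (1 / 2 : ℝ) 1, ∑ n ∈ s, ‖coeff f n‖ ^ 2 * r ^ (2 * n) ≤ C := by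
    intro r hr
    have h0 : 0 < r := by linarith [hr.1]
    have hP := hasSum_norm_sq_coeff hd h0.le hr.2
    refine (sum_le_hasSum s (fun n _ => mul_nonneg (by positivity) (pow_nonneg h0.le _)) hP).trans ?_
    refine le_trans (le_of_eq ?_) (hC r h0.le hr.2)
    have hint : Integrable (fun ζ => ‖f (r * ζ)‖ ^ 2) m := by
      refine integrable_m_of_continuousOn (ContinuousOn.pow (ContinuousOn.norm ?_) 2)
      refine hd.continuousOn.comp (by fun_prop) fun ζ hζ => ?_
      exact radial_mem_disc h0 hr.2 (by simpa using hζ)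
    rw [integral_m hint.1, Real.circleAverage_def, Real.circleAverage_def]
    simp [circleMap]
  have hlim : Filter.Tendsto (fun r : ℝ => ∑ n ∈ s, ‖coeff f n‖ ^ 2 * r ^ (2 * n)) (𝓝[<] 1)
      (𝓝 (∑ n ∈ s, ‖coeff f n‖ ^ 2)) := by
    have : Continuous fun r : ℝ => ∑ n ∈ s, ‖coeff f n‖ ^ 2 * r ^ (2 * n) := by fun_prop
    simpa using (this.tendsto 1).mono_left nhdsWithin_le_nhds
  refine le_of_tendsto hlim ?_
  filter_upwards [Ioo_half_one_mem] with r h using hr r h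

theorem tendsto_eval_truncation {f : ℂ → ℂ} (hf : DifferentiableOn ℂ f disc) {z : ℂ}
    (hz : z ∈ disc) :
    Filter.Tendsto (fun N => (truncation (coeff f) N).eval z) Filter.atTop (𝓝 (f z)) := by
  simp_rw [eval_truncation]
  exact (hasSum_coeff hf hz).tendsto_sum_nat

theorem tendsto_deriv_eval_truncation {f : ℂ → ℂ} (hf : DifferentiableOn ℂ f disc) {z : ℂ}
    (hz : z ∈ disc) :
    Filter.Tendsto (fun N => deriv (fun z => (truncation (coeff f) N).eval z) z) Filter.atTop
      (𝓝 (deriv f z)) := by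
  -- Differentiation kills the constant term, so the truncation of length `N + 1` yields `N` terms
  -- of the series of `deriv f`.
  rw [← Filter.tendsto_add_atTop_iff_nat 1]
  refine (hasSum_coeff_deriv hf hz).tendsto_sum_nat.congr fun N => ?_
  rw [Polynomial.deriv, truncation, Polynomial.derivative_sum, Polynomial.eval_finsetSum,
    Finset.sum_range_succ']
  simp
  exact Finset.sum_congr rfl fun n _ => by ring

theorem tendsto_eLpNorm_σ {u : ℕ → ℂ → ℂ} {w : ℂ} (hw : w ∈ disc)
    (h : Filter.Tendsto (fun N => eLpNorm (u N) 2 m) Filter.atTop (𝓝 0)) :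
    Filter.Tendsto (fun N => eLpNorm (u N) 2 (σ w)) Filter.atTop (𝓝 0) := by
  set K : ℝ≥0∞ := ENNReal.ofReal ((1 - ‖w‖ ^ 2) / (1 - ‖w‖) ^ 2) with hK
  have hK' : K ^ (1 / (2 : ℝ≥0∞)).toReal ≠ ⊤ :=
    ENNReal.rpow_ne_top_of_nonneg (by positivity) ENNReal.ofReal_ne_top
  have h1 := ENNReal.Tendsto.const_mul h (Or.inr hK')
  rw [mul_zero] at h1
  refine tendsto_of_tendsto_of_tendsto_of_le_of_le tendsto_const_nhds h1 (fun _ => zero_le)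
    fun N => ?_
  refine (eLpNorm_mono_measure _ (σ_le hw)).trans (le_of_eq ?_)
  rw [eLpNorm_smul_measure_of_ne_top (by norm_num), smul_eq_mul]

/-- An `H²` function is the Poisson integral of its boundary function. -/
theorem integral_σ_boundary {f : ℂ → ℂ} (hf : DifferentiableOn ℂ f disc) {u : ℂ → ℂ}
    (hu : MemLp u 2 m) (hlim : Filter.Tendsto
      (fun N => eLpNorm ((fun ζ => (truncation (coeff f) N).eval ζ) - u) 2 m)
        Filter.atTop (𝓝 0)) {z : ℂ} (hz : z ∈ disc) : ∫ ζ, u ζ ∂(σ z) = f z := by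
  have := isProbabilityMeasure_σ hz
  have hui : Integrable u (σ z) := integrable_σ hz (hu.integrable (by norm_num))
  have hpi : ∀ N, Integrable (fun ζ => (truncation (coeff f) N).eval ζ) (σ z) := fun N =>
    integrable_σ hz ((memLp_eval _).integrable (by norm_num))
  have h1 : Filter.Tendsto
      (fun N => eLpNorm ((fun ζ => (truncation (coeff f) N).eval ζ) - u) 1 (σ z))
      Filter.atTop (𝓝 0) :=
    tendsto_of_tendsto_of_tendsto_of_le_of_le tendsto_const_nhds (tendsto_eLpNorm_σ hz hlim)
      (fun _ => zero_le) fun N =>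
        eLpNorm_le_eLpNorm_of_exponent_le (by norm_num) ((hpi N).sub hui).1
  have h2 := tendsto_integral_of_L1' u hui.1 (.of_forall hpi) h1
  have h3 : ∀ N, ∫ ζ, (truncation (coeff f) N).eval ζ ∂(σ z) = (truncation (coeff f) N).eval z :=
    fun N => integral_σ_of_diffContOnCl (Polynomial.differentiable _).diffContOnCl hz
  simp_rw [h3] at h2
  exact tendsto_nhds_unique h2 (tendsto_eval_truncation hf hz)

/-! ### The Littlewood–Paley identity in `H²` -/

theorem measurable_greenKernel : Measurable fun p : ℂ × ℂ => greenKernel p.1 p.2 := by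
  unfold greenKernel
  refine Measurable.ite (measurableSet_eq_fun (by fun_prop) (by fun_prop)) measurable_const ?_
  have : Measurable fun z : ℂ => conj z := Complex.continuous_conj.measurable
  fun_prop

/-- The area measure weighted by the Green kernel with pole `w`. -/
noncomputable def greenArea (w : ℂ) : Measure ℂ := area.withDensity fun z => greenKernel z w

theorem eLpNorm_deriv_greenArea_sq (g : ℂ → ℂ) (w : ℂ) :
    eLpNorm (deriv g) 2 (greenArea w) ^ 2 =
      ∫⁻ z, ENNReal.ofReal (‖deriv g z‖ ^ 2) * greenKernel z w ∂area := by
  have h1 : Measurable fun z => greenKernel z w :=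
    measurable_greenKernel.comp (measurable_id.prodMk measurable_const)
  have h2 : Measurable (deriv g) := measurable_deriv g
  rw [eLpNorm_two_sq, greenArea, lintegral_withDensity_eq_lintegral_mul _ h1 (by fun_prop)]
  simp only [Pi.mul_apply, mul_comm]

theorem eLpNorm_deriv_eval_sq (p : Polynomial ℂ) {w : ℂ} (hw : w ∈ disc) :
    eLpNorm (deriv fun z => p.eval z) 2 (greenArea w) ^ 2 =
      eLpNorm (fun ζ => p.eval ζ) 2 (σ w) ^ 2 - ENNReal.ofReal (‖p.eval w‖ ^ 2) := by
  rw [eLpNorm_deriv_greenArea_sq, lintegral_deriv_sq_greenKernel_eval p hw, eLpNorm_two_sq,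
    ← ofReal_integral_eq_lintegral_ofReal (integrable_σ hw (integrable_m_norm_sq_eval p))
      (.of_forall fun _ => by positivity), ENNReal.ofReal_sub _ (by positivity)]

/-- Differentiation is a contraction from `L²(σ w)` to `L²(greenArea w)` on polynomials; applied to
differences, it transports convergence. -/
theorem eLpNorm_deriv_eval_le (p : Polynomial ℂ) {w : ℂ} (hw : w ∈ disc) :
    eLpNorm (deriv fun z => p.eval z) 2 (greenArea w) ≤ eLpNorm (fun ζ => p.eval ζ) 2 (σ w) := by
  rw [← ENNReal.pow_le_pow_left_iff two_ne_zero, eLpNorm_deriv_eval_sq p hw]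
  exact tsub_le_self

/-- **Littlewood–Paley identity** for `H²` functions, with an arbitrary pole. -/
theorem lintegral_deriv_sq_greenKernel_eq {f : ℂ → ℂ} (hf : DifferentiableOn ℂ f disc) {u : ℂ → ℂ}
    (hu : MemLp u 2 m) (hlim : Filter.Tendsto
      (fun N => eLpNorm ((fun ζ => (truncation (coeff f) N).eval ζ) - u) 2 m)
        Filter.atTop (𝓝 0)) {w : ℂ} (hw : w ∈ disc) :
    ∫⁻ z, ENNReal.ofReal (‖deriv f z‖ ^ 2) * greenKernel z w ∂area =
      ∫⁻ ζ, ENNReal.ofReal (‖u ζ‖ ^ 2) ∂(σ w) - ENNReal.ofReal (‖f w‖ ^ 2) := by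
  set p : ℕ → Polynomial ℂ := truncation (coeff f) with hp
  have hum : AEStronglyMeasurable u (σ w) := hu.1.mono_ac (σ_absolutelyContinuous w)
  have hpm : ∀ N, AEStronglyMeasurable (fun ζ => (p N).eval ζ) (σ w) := fun N =>
    (p N).continuous.aestronglyMeasurable
  have hσ := tendsto_eLpNorm_σ hw hlim
  -- The contraction is applied to `p N - p M` and `M` is sent to infinity: derivatives converge
  -- pointwise in the disc, so Fatou's lemma bounds the left side, while the right side converges in
  -- `L²(σ w)`.
  have hderiv : ∀ N, eLpNorm ((deriv fun z => (p N).eval z) - deriv f) 2 (greenArea w) ≤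
      eLpNorm ((fun ζ => (p N).eval ζ) - u) 2 (σ w) := by
    intro N
    have hconv : Filter.Tendsto
        (fun M => eLpNorm ((fun ζ => (p N).eval ζ) - fun ζ => (p M).eval ζ) 2 (σ w))
        Filter.atTop (𝓝 (eLpNorm ((fun ζ => (p N).eval ζ) - u) 2 (σ w))) := by
      refine tendsto_eLpNorm_of_tendsto_sub (fun M => (hpm N).sub (hpm M)) ((hpm N).sub hum) ?_
      refine hσ.congr fun M => ?_
      rw [← eLpNorm_neg]
      congr 1
      funext ζ
      simp
    have hle : ∀ M, eLpNorm ((deriv fun z => (p N).eval z) - deriv fun z => (p M).eval z) 2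
        (greenArea w) ≤ eLpNorm ((fun ζ => (p N).eval ζ) - fun ζ => (p M).eval ζ) 2 (σ w) := by
      intro M
      convert! eLpNorm_deriv_eval_le (p N - p M) hw using 2
      · funext z
        rw [Pi.sub_apply, Polynomial.deriv, Polynomial.deriv, Polynomial.deriv,
          Polynomial.derivative_sub, Polynomial.eval_sub]
      · funext ζ
        simp
    refine (Lp.eLpNorm_lim_le_liminf_eLpNorm (f := fun M =>
      (deriv fun z => (p N).eval z) - deriv fun z => (p M).eval z)
      (fun M => ((measurable_deriv _).sub (measurable_deriv _)).aestronglyMeasurable) _ ?_).trans ?_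
    · have hd : ∀ᵐ z ∂area, z ∈ disc :=
        Measure.ae_smul_measure (ae_restrict_mem measurableSet_disc) _
      filter_upwards [(withDensity_absolutelyContinuous _ _).ae_le hd] with z hz
      exact tendsto_const_nhds.sub (tendsto_deriv_eval_truncation hf hz)
    · rw [← hconv.liminf_eq]
      exact Filter.liminf_le_liminf (.of_forall hle)
  have hA := tendsto_eLpNorm_of_tendsto_sub hpm hum hσ
  have hB : Filter.Tendsto (fun N => eLpNorm (deriv fun z => (p N).eval z) 2 (greenArea w))
      Filter.atTop (𝓝 (eLpNorm (deriv f) 2 (greenArea w))) :=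
    tendsto_eLpNorm_of_tendsto_sub (fun N => (measurable_deriv _).aestronglyMeasurable)
      (measurable_deriv _).aestronglyMeasurable
      (tendsto_of_tendsto_of_tendsto_of_le_of_le tendsto_const_nhds hσ (fun _ => zero_le) hderiv)
  have hC : Filter.Tendsto (fun N => ENNReal.ofReal (‖(p N).eval w‖ ^ 2)) Filter.atTop
      (𝓝 (ENNReal.ofReal (‖f w‖ ^ 2))) :=
    ENNReal.tendsto_ofReal ((tendsto_eval_truncation hf hw).norm.pow 2)
  rw [← eLpNorm_deriv_greenArea_sq, ← eLpNorm_two_sq]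
  refine tendsto_nhds_unique (ENNReal.Tendsto.pow (n := 2) hB) ?_
  simp_rw [eLpNorm_deriv_eval_sq _ hw]
  exact ENNReal.Tendsto.sub (ENNReal.Tendsto.pow hA) hC (Or.inr ENNReal.ofReal_ne_top)

/-! ### Outer functions -/

/-- The modulus of an outer function is the exponential of a Poisson integral. -/
theorem norm_exp_herglotz {h : ℂ → ℝ} (hh : Integrable h m) {z : ℂ} (hz : z ∈ disc) :
    ‖Complex.exp (∫ ζ, (ζ + z) / (ζ - z) * (h ζ : ℂ) ∂m)‖ = Real.exp (∫ ζ, h ζ ∂(σ z)) := by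
  have hz1 := norm_lt_one_of_mem_disc hz
  have hbound : ∀ᵐ ζ ∂m, ‖(ζ + z) / (ζ - z)‖ ≤ 2 / (1 - ‖z‖) := by
    filter_upwards [ae_m_norm_eq_one] with ζ hζ
    rw [norm_div]
    have h1 : ‖ζ + z‖ ≤ 2 := (norm_add_le _ _).trans (by linarith)
    have h2 : 1 - ‖z‖ ≤ ‖ζ - z‖ := by simpa [hζ] using norm_sub_norm_le ζ z
    have h3 : 0 < 1 - ‖z‖ := by linarith
    gcongr
  have hint : Integrable (fun ζ => (ζ + z) / (ζ - z) * (h ζ : ℂ)) m :=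
    hh.ofReal.bdd_mul (Measurable.aestronglyMeasurable (by fun_prop)) hbound
  rw [Complex.norm_exp, integral_σ hz]
  congr 1
  refine (Complex.reCLM.integral_comp_comm hint).symm.trans (integral_congr_ae ?_)
  filter_upwards [ae_m_norm_eq_one] with ζ hζ
  have hre := congrFun (poissonKernel_eq_re_herglotzRieszKernel (c := 0) (w := z)) ζ
  simp only [poissonKernel, herglotzRieszKernel, sub_zero, hζ, one_pow, Function.comp_apply] at hre
  simp only [Complex.reCLM_apply, Complex.re_mul_ofReal, smul_eq_mul, poisson]
  rw [hre]

/-- Poisson integrals of complex functions have radial limits almost everywhere. -/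
theorem ae_tendsto_integral_σ_radial_complex {u : ℂ → ℂ} (hu : Integrable u m) :
    ∀ᵐ ζ ∂m, Filter.Tendsto (fun r : ℝ => ∫ ξ, u ξ ∂(σ (r * ζ))) (𝓝[<] 1) (𝓝 (u ζ)) := by
  filter_upwards [ae_tendsto_integral_σ_radial hu.re, ae_tendsto_integral_σ_radial hu.im,
    ae_m_norm_eq_one] with ζ h1 h2 hζ
  have h : Filter.Tendsto (fun r : ℝ => ((∫ ξ, (u ξ).re ∂(σ (r * ζ)) : ℝ) : ℂ) +
      ((∫ ξ, (u ξ).im ∂(σ (r * ζ)) : ℝ) : ℂ) * Complex.I) (𝓝[<] 1)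
      (𝓝 (((u ζ).re : ℂ) + ((u ζ).im : ℂ) * Complex.I)) :=
    ((Complex.continuous_ofReal.tendsto _).comp h1).add
      (((Complex.continuous_ofReal.tendsto _).comp h2).mul_const Complex.I)
  rw [Complex.re_add_im] at h
  refine h.congr' ?_
  filter_upwards [Ioo_half_one_mem] with r hr
  exact integral_re_add_im (𝕜 := ℂ)
    (integrable_σ (radial_mem_disc (by linarith [hr.1]) hr.2 hζ) hu)

theorem F_nonneg (x y : ℝ) : 0 ≤ F x y := by
  have h := Real.add_one_le_exp (x - y)
  have : F x y = Real.exp y * (Real.exp (x - y) - (x - y + 1)) := by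
    have hx : Real.exp x = Real.exp y * Real.exp (x - y) := by rw [← Real.exp_add]; ring_nf
    rw [F, hx]
    ring
  rw [this]
  exact mul_nonneg (Real.exp_pos _).le (by linarith)

/-- The Bregman variational formula: the mean Bregman divergence is minimal at the mean. -/
theorem iInf_lintegral_F {ν : Measure ℂ} [IsProbabilityMeasure ν] {k : ℂ → ℝ}
    (hk : Integrable k ν) (hexp : Integrable (fun ζ => Real.exp (k ζ)) ν) :
    ⨅ a : ℝ, ∫⁻ ζ, ENNReal.ofReal (F (k ζ) a) ∂ν =
      ENNReal.ofReal (∫ ζ, Real.exp (k ζ) ∂ν - Real.exp (∫ ζ, k ζ ∂ν)) := by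
  -- The part of `F(k, a)` depending on `k` is `exp k` minus a multiple of `k`, so replacing `k` by
  -- its mean changes the integral by exactly the Jensen gap.
  have hval : ∀ a, ∫⁻ ζ, ENNReal.ofReal (F (k ζ) a) ∂ν = ENNReal.ofReal
      (∫ ζ, Real.exp (k ζ) ∂ν - Real.exp (∫ ζ, k ζ ∂ν) + F (∫ ζ, k ζ ∂ν) a) := by
    intro a
    have h1 : Integrable (fun ζ => Real.exp (k ζ) - Real.exp a) ν := hexp.sub (integrable_const _)
    have h2 : Integrable (fun ζ => Real.exp a * (k ζ - a)) ν :=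
      (hk.sub (integrable_const _)).const_mul _
    have h3 : Integrable (fun ζ => F (k ζ) a) ν := h1.sub h2
    rw [← ofReal_integral_eq_lintegral_ofReal h3 (.of_forall fun ζ => F_nonneg _ _)]
    congr 1
    simp only [F]
    rw [integral_sub h1 h2, integral_sub hexp (integrable_const _), integral_const_mul,
      integral_sub hk (integrable_const _)]
    simp only [integral_const, probReal_univ, one_smul]
    ring
  refine le_antisymm ((iInf_le _ (∫ ζ, k ζ ∂ν)).trans (le_of_eq ?_)) (le_iInf fun a => ?_)
  · rw [hval]
    simp [F]
  · rw [hval]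
    exact ENNReal.ofReal_le_ofReal (by linarith [F_nonneg (∫ ζ, k ζ ∂ν) a])

/-- The pointwise identity: the Green-weighted Dirichlet integral of an outer function with a
single pole is the minimal mean Bregman divergence. -/
theorem lintegral_deriv_sq_greenKernel_eq_iInf {f : ℂ → ℂ} (hf : MemHardy 2 f) (hout : IsOuter f)
    {w : ℂ} (hw : w ∈ disc) :
    ∫⁻ z, ENNReal.ofReal (‖deriv f z‖ ^ 2) * greenKernel z w ∂area =
      ⨅ a : ℝ, ∫⁻ ζ, ENNReal.ofReal (F (2 * Real.log ‖boundaryValue f ζ‖) a) ∂(σ w) := by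
  obtain ⟨-, α, h, hα, hh, hrep⟩ := hout
  obtain ⟨u, hu, hlim⟩ := exists_tendsto_truncation (summable_norm_sq_coeff hf)
  have hnorm : ∀ z ∈ disc, ‖f z‖ = Real.exp (∫ ζ, h ζ ∂(σ z)) := fun z hz => by
    rw [hrep z hz, norm_mul, hα, one_mul, norm_exp_herglotz hh hz]
  have hui : Integrable u m := hu.integrable (by norm_num)
  -- Fatou's theorem is used twice along the same radius: `f` is the Poisson integral of `u`, and
  -- `‖f‖` the exponential of that of `h`. In particular `u` is almost everywhere nonzero, so the
  -- default `Real.log 0 = 0` plays no role.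
  have hboundary : ∀ᵐ ζ ∂m, boundaryValue f ζ = u ζ ∧ ‖u ζ‖ = Real.exp (h ζ) := by
    filter_upwards [ae_tendsto_integral_σ_radial_complex hui, ae_tendsto_integral_σ_radial hh,
      ae_m_norm_eq_one] with ζ h1 h2 hζ
    have hmem : ∀ᶠ r : ℝ in 𝓝[<] 1, (r : ℂ) * ζ ∈ disc := by
      filter_upwards [Ioo_half_one_mem] with r hr
      exact radial_mem_disc (by linarith [hr.1]) hr.2 hζ
    have h3 : Filter.Tendsto (fun r : ℝ => f (r * ζ)) (𝓝[<] 1) (𝓝 (u ζ)) := by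
      refine h1.congr' ?_
      filter_upwards [hmem] with r hr using integral_σ_boundary hf.1 hu hlim hr
    refine ⟨h3.limUnder_eq, tendsto_nhds_unique h3.norm ?_⟩
    refine ((Real.continuous_exp.tendsto _).comp h2).congr' ?_
    filter_upwards [hmem] with r hr using (hnorm _ hr).symm
  have hσ : ∀ᵐ ζ ∂(σ w), boundaryValue f ζ = u ζ ∧ ‖u ζ‖ = Real.exp (h ζ) :=
    (σ_absolutelyContinuous w).ae_le hboundary
  have hprob := isProbabilityMeasure_σ hw
  have hk : Integrable (fun ζ => 2 * h ζ) (σ w) := (integrable_σ hw hh).const_mul 2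
  have hsq : (fun ζ => ‖u ζ‖ ^ 2) =ᵐ[σ w] fun ζ => Real.exp (2 * h ζ) := by
    filter_upwards [hσ] with ζ hζ
    rw [hζ.2, ← Real.exp_nat_mul]
    norm_num
  have husq : Integrable (fun ζ => ‖u ζ‖ ^ 2) (σ w) :=
    integrable_σ hw ((memLp_two_iff_integrable_sq_norm hu.1).1 hu)
  have hcongr : ∀ a : ℝ, ∫⁻ ζ, ENNReal.ofReal (F (2 * Real.log ‖boundaryValue f ζ‖) a) ∂(σ w) =
      ∫⁻ ζ, ENNReal.ofReal (F (2 * h ζ) a) ∂(σ w) := fun a => by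
    refine lintegral_congr_ae ?_
    filter_upwards [hσ] with ζ hζ
    rw [hζ.1, hζ.2, Real.log_exp]
  have hfw : ‖f w‖ ^ 2 = Real.exp (∫ ζ, 2 * h ζ ∂(σ w)) := by
    rw [hnorm w hw, integral_const_mul, ← Real.exp_nat_mul]
    norm_num
  simp_rw [hcongr]
  rw [iInf_lintegral_F hk (husq.congr hsq), lintegral_deriv_sq_greenKernel_eq hf.1 hu hlim hw, hfw,
    ENNReal.ofReal_sub _ (Real.exp_pos _).le, ← integral_congr_ae hsq,
    ofReal_integral_eq_lintegral_ofReal husq (.of_forall fun _ => by positivity)]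

/-- The measure with density `1 - ‖w‖²` is finite, and this density is positive and finite on the
disc; dividing by it recovers `μ` there. Tonelli's theorem needs this s-finiteness, as `μ` may have
infinite mass near the circle. -/
theorem sFinite_restrict_disc {μ : Measure ℂ}
    (hμ : ∫⁻ w in disc, ENNReal.ofReal (1 - ‖w‖ ^ 2) ∂μ < ⊤) : SFinite (μ.restrict disc) := by
  set ρ : ℂ → ℝ≥0∞ := fun w => ENNReal.ofReal (1 - ‖w‖ ^ 2) with hρ
  have hρm : Measurable ρ := by fun_prop
  have hfin : IsFiniteMeasure ((μ.restrict disc).withDensity ρ) :=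
    isFiniteMeasure_withDensity hμ.ne
  have hpos : ∀ᵐ w ∂(μ.restrict disc), ρ w ≠ 0 := by
    filter_upwards [ae_restrict_mem measurableSet_disc] with w hw
    have := norm_lt_one_of_mem_disc hw
    simp only [hρ, ne_eq, ENNReal.ofReal_eq_zero, not_le]
    nlinarith [norm_nonneg w]
  rw [← withDensity_inv_same hρm hpos (.of_forall fun _ => ENNReal.ofReal_ne_top)]
  infer_instance

end DirichletOuter

theorem theorem2p2 (μ : MeasureTheory.Measure ℂ)
    (hμ : ∫⁻ w in DirichletOuter.disc, ENNReal.ofReal (1 - ‖w‖ ^ 2) ∂μ < ⊤)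
    (f : ℂ → ℂ) (hf : DirichletOuter.MemHardy 2 f) (hout : DirichletOuter.IsOuter f) :
    DirichletOuter.dirichletIntegral (DirichletOuter.greenPotential μ) f =
      ∫⁻ w in DirichletOuter.disc,
        (⨅ a : ℝ, ∫⁻ ζ, ENNReal.ofReal
          (DirichletOuter.F (2 * Real.log ‖DirichletOuter.boundaryValue f ζ‖) a)
            ∂(DirichletOuter.σ w)) ∂μ := by
  have hs := DirichletOuter.sFinite_restrict_disc hμ
  have harea : SFinite DirichletOuter.area := by
    unfold DirichletOuter.area
    infer_instance
  have hG := DirichletOuter.measurable_greenKernel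
  have hd : Measurable (deriv f) := measurable_deriv f
  have hGz : ∀ z, Measurable fun w => DirichletOuter.greenKernel z w := fun z =>
    hG.comp (measurable_const.prodMk measurable_id)
  have hjoint : Measurable fun p : ℂ × ℂ =>
      ENNReal.ofReal (‖deriv f p.1‖ ^ 2) * DirichletOuter.greenKernel p.1 p.2 :=
    (by fun_prop : Measurable fun p : ℂ × ℂ => ENNReal.ofReal (‖deriv f p.1‖ ^ 2)).mul hG
  unfold DirichletOuter.dirichletIntegral DirichletOuter.greenPotential
  simp_rw [← lintegral_const_mul _ (hGz _)]
  -- Tonelli reduces the claim to the single-pole identity for each `w` in the disc.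
  rw [lintegral_lintegral_swap hjoint.aemeasurable]
  exact setLIntegral_congr_fun DirichletOuter.measurableSet_disc fun w hw =>
    DirichletOuter.lintegral_deriv_sq_greenKernel_eq_iInf hf hout hw
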